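/- For $\gamma\in[0,1]$ let $\mathcal A_\gamma$ be the qubit amplitude damping channel with Kraus operators $|0\rangle\langle 0|+\sqrt{1-\gamma}\,|1\rangle\langle 1|$ and $\sqrt\gamma\,|0\rangle\langle 1|$. For channels $\mathcal N_1,\mathcal N_2$, a rate $R$ is achievable if for every $n\ge 1$ there are a source state $\rho_n$ on $S_1^n S_2^n$ and an LOCC operation $\mathcal L_n$ between the two receivers (finitely many rounds) such that, with $\Phi=\frac12\sum_{a,b\in\{0,1\}}|aa\rangle\langle bb|$ the EPR state, $$\big\|\Phi^{\otimes \kappa_n}-\mathcal L_n\big((\mathcal N_1^{\otimes n}\otimes\mathcal N_2^{\otimes n})(\rho_n)\big)\big\|_1\le\varepsilon_n,\qquad \kappa_n/n\to R,\quad \varepsilon_n\to0 .$$ The EPR distribution capacity $E(\mathcal N_1,\mathcal N_2)$ is the supremum of the achievable rates. For $k\ge1$ let $|\psi_k\rangle=\frac1{\sqrt k}\sum_{i=1}^k|e_i\rangle|e_i\rangle$, where $|e_i\rangle$ is the $k$-qubit basis state with a single $1$, at position $i$; let $\psi_k=|\psi_k\rangle\langle\psi_k|$, let $P=\sum_{i=1}^k|e_i\rangle\langle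 e_i|$ be the projection onto the one-particle sector, and let $\rho=(\mathcal A_{\gamma_1}^{\otimes k}\otimes\mathcal A_{\gamma_2}^{\otimes k})(\psi_k)$. Then for all $\gamma_1,\gamma_2\in[0,1]$: 1. For every $k\ge1$, $\operatorname{Tr}\,(P\otimes P)\rho(P\otimes P)=(1-\gamma_1)(1-\gamma_2)$, and if this is nonzero the post-selected state $(P\otimes P)\rho(P\otimes P)/\operatorname{Tr}\,(P\otimes P)\rho(P\otimes P)$ equals $\psi_k$, a maximally entangled state of Schmidt rank $k$. 2. For every $k\ge1$, the rate $(1-\gamma_1)(1-\gamma_2)\frac{\log_2 k}{k}$ of EPR pairs per channel use is achieved asymptotically (as $m\to\infty$, with error tending to $0$ in trace norm) by the protocol that sends $\psi_k^{\otimes m}$ through $mk$ uses of each channel, has each receiver test every block of $k$ qubits with $\{P,1-P\}$, discards all blocks on which at least one of the tests fails, and applies LOCC to the remaining blocks. Consequently $$E(\mathcal A_{\gamma_1},\mathcal A_{\gamma_2})\ \ge\ (1-\gamma_1)(1-\gamma_2)\,\frac{\log_2 k}{k}.$$ 3. Over all integers $k\ge1$, $\frac{\log_2 k}{k}$, and hence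 the rate in 2, is maximal at $k=3$; so the largest of these rates is $(1-\gamma_1)(1-\gamma_2)\frac{\log_2 3}{3}$, and $$E(\mathcal A_{\gamma_1},\mathcal A_{\gamma_2})\ \ge\ (1-\gamma_1)(1-\gamma_2)\,\frac{\log_2 3}{3}.$$ -/

import Mathlib

open scoped ComplexOrder Kronecker

namespace EPRDist

noncomputable section

/-! ### Linear maps on matrix algebras -/

/-- Operators on the finite-dimensional space `ℂ^A` (with `A` an index set of basis vectors). -/
abbrev Op (A : Type) : Type := Matrix A A ℂ

/-- Linear maps from operators on `ℂ^A` to operators on `ℂ^B`. -/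
abbrev SuperOp (A B : Type) : Type := Op A →ₗ[ℂ] Op B

/-- `Φ ⊗ id_C`, acting on operators on `ℂ^A ⊗ ℂ^C`: `Φ` is applied to the `A`-blocks. -/
def onLeft {A B : Type} (C : Type) (Φ : SuperOp A B) : SuperOp (A × C) (B × C) where
  toFun ρ := Matrix.of fun p q => Φ (Matrix.of fun i j => ρ (i, p.2) (j, q.2)) p.1 q.1
  map_add' ρ σ := by
    ext p q
    exact congrFun (congrFun (Φ.map_add (Matrix.of fun i j => ρ (i, p.2) (j, q.2))
      (Matrix.of fun i j => σ (i, p.2) (j, q.2))) p.1) q.1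
  map_smul' c ρ := by
    ext p q
    exact congrFun (congrFun (Φ.map_smul c (Matrix.of fun i j => ρ (i, p.2) (j, q.2))) p.1) q.1

/-- `id_C ⊗ Φ`, acting on operators on `ℂ^C ⊗ ℂ^A`. -/
def onRight {A B : Type} (C : Type) (Φ : SuperOp A B) : SuperOp (C × A) (C × B) where
  toFun ρ := Matrix.of fun p q => Φ (Matrix.of fun i j => ρ (p.1, i) (q.1, j)) p.2 q.2
  map_add' ρ σ := by
    ext p q
    exact congrFun (congrFun (Φ.map_add (Matrix.of fun i j => ρ (p.1, i) (q.1, j))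
      (Matrix.of fun i j => σ (p.1, i) (q.1, j))) p.2) q.2
  map_smul' c ρ := by
    ext p q
    exact congrFun (congrFun (Φ.map_smul c (Matrix.of fun i j => ρ (p.1, i) (q.1, j))) p.2) q.2

/-- `Φ ⊗ Ψ`. -/
def tensorMap {A B C D : Type} (Φ : SuperOp A B) (Ψ : SuperOp C D) : SuperOp (A × C) (B × D) :=
  (onRight B Ψ).comp (onLeft C Φ)

/-- The tensor power `Φ^{⊗ n}`, acting on operators on `(ℂ^A)^{⊗ n} = ℂ^(Fin n → A)`.
On a matrix unit `|k⟩⟨l| = ⨂ₜ |k t⟩⟨l t|` it takes the value `⨂ₜ Φ(|k t⟩⟨l t|)`. -/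
def tensorPow {A B : Type} [Fintype A] [DecidableEq A] (n : ℕ) (Φ : SuperOp A B) :
    SuperOp (Fin n → A) (Fin n → B) where
  toFun ρ := Matrix.of fun i j =>
    ∑ k, ∑ l, ρ k l * ∏ t, Φ (Matrix.single (k t) (l t) 1) (i t) (j t)
  map_add' ρ σ := by
    ext i j
    simp [add_mul, Finset.sum_add_distrib]
  map_smul' c ρ := by
    ext i j
    simp [mul_assoc, Finset.mul_sum]

/-- Complete positivity: every `id_{ℂ^r} ⊗ Φ` maps positive semidefinite operators to
positive semidefinite operators. -/
def IsCP {A B : Type} (Φ : SuperOp A B) : Prop :=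
  ∀ (r : ℕ) (ρ : Op (Fin r × A)), ρ.PosSemidef → (onRight (Fin r) Φ ρ).PosSemidef

/-- The map with Kraus operators `K i`, `ρ ↦ ∑ i, K i ρ (K i)ᴴ`. -/
def krausMap {A B ι : Type} [Fintype A] [Fintype ι] (K : ι → Matrix B A ℂ) : SuperOp A B where
  toFun ρ := ∑ i, K i * ρ * (K i).conjTranspose
  map_add' ρ σ := by simp [Matrix.mul_add, Matrix.add_mul, Finset.sum_add_distrib]
  map_smul' c ρ := by simp [Finset.smul_sum, Matrix.mul_smul, Matrix.smul_mul]

/-- Density operators. -/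
def IsState {A : Type} [Fintype A] (ρ : Op A) : Prop := ρ.PosSemidef ∧ ρ.trace = 1

open scoped MatrixOrder in
/-- The trace norm `‖X‖₁ = Tr √(Xᴴ X)`. -/
def traceNorm {A : Type} [Fintype A] [DecidableEq A] (X : Op A) : ℝ :=
  (CFC.abs X).trace.re

/-- The operator `|v⟩⟨v|`. -/
def pureState {A : Type} (v : A → ℂ) : Op A := Matrix.vecMulVec v (star v)

/-! ### LOCC -/

/-- A quantum instrument with outcomes `x : X` whose output space may depend on the outcome:
completely positive maps whose sum preserves the trace. -/
def IsInstrument {A X : Type} [Fintype A] [Fintype X] {C : X → Type} [∀ x, Fintype (C x)]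
    (M : ∀ x, SuperOp A (C x)) : Prop :=
  (∀ x, IsCP (M x)) ∧ ∀ ρ : Op A, ∑ x, (M x ρ).trace = ρ.trace

/-- Bipartite LOCC operations from `A ⊗ B` to `A' ⊗ B'` with finitely many rounds of classical
communication: in each round one party applies a local instrument and announces the
outcome, and everything done afterwards may depend on it. -/
inductive IsLOCC : (A B A' B' : Type) → SuperOp (A × B) (A' × B') → Prop
  | done (A B : Type) : IsLOCC A B A B LinearMap.id
  | left {A B A' B' X : Type} [Fintype A] [Fintype X] {C : X → Type} [∀ x, Fintype (C x)]
      (M : ∀ x, SuperOp A (C x)) (L : ∀ x, SuperOp (C x × B) (A' × B'))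
      (hM : IsInstrument M) (hL : ∀ x, IsLOCC (C x) B A' B' (L x)) :
      IsLOCC A B A' B' (∑ x, (L x).comp (onLeft B (M x)))
  | right {A B A' B' X : Type} [Fintype B] [Fintype X] {C : X → Type} [∀ x, Fintype (C x)]
      (M : ∀ x, SuperOp B (C x)) (L : ∀ x, SuperOp (A × C x) (A' × B'))
      (hM : IsInstrument M) (hL : ∀ x, IsLOCC A (C x) A' B' (L x)) :
      IsLOCC A B A' B' (∑ x, (L x).comp (onRight A (M x)))

/-! ### EPR distribution -/

/-- `n` copies of a bipartite operator on `ℂ^A ⊗ ℂ^B`, regarded as a bipartite operator on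
`(ℂ^A)^{⊗ n} ⊗ (ℂ^B)^{⊗ n}`. -/
def copies {A B : Type} (n : ℕ) (ρ : Op (A × B)) : Op ((Fin n → A) × (Fin n → B)) :=
  Matrix.of fun p q => ∏ t, ρ (p.1 t, p.2 t) (q.1 t, q.2 t)

/-- The EPR state, the projector onto `(|00⟩ + |11⟩)/√2`. -/
def epr : Op (Fin 2 × Fin 2) :=
  pureState fun p => if p.1 = p.2 then ((1 / √2 : ℝ) : ℂ) else 0

variable {S₁ S₂ A₁ A₂ : Type} [Fintype S₁] [Fintype S₂] [Fintype A₁] [Fintype A₂]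
  [DecidableEq S₁] [DecidableEq S₂]

/-- There is a code that uses each channel `n` times and distributes `κ` EPR pairs with error at
most `ε`: a source state `ρ` on `S₁ⁿ ⊗ S₂ⁿ` and an LOCC post-processing `L` by the receivers. -/
def HasEPRCode (N₁ : SuperOp S₁ A₁) (N₂ : SuperOp S₂ A₂) (n κ : ℕ) (ε : ℝ) : Prop :=
  ∃ (ρ : Op ((Fin n → S₁) × (Fin n → S₂)))
    (L : SuperOp ((Fin n → A₁) × (Fin n → A₂)) ((Fin κ → Fin 2) × (Fin κ → Fin 2))),
    IsState ρ ∧ IsLOCC _ _ _ _ L ∧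
    traceNorm (copies κ epr - L (tensorMap (tensorPow n N₁) (tensorPow n N₂) ρ)) ≤ ε

/-- `R` EPR pairs per channel use are asymptotically achievable. -/
def IsAchievable (N₁ : SuperOp S₁ A₁) (N₂ : SuperOp S₂ A₂) (R : ℝ) : Prop :=
  ∃ (κ : ℕ → ℕ) (ε : ℕ → ℝ), (∀ n, 1 ≤ n → HasEPRCode N₁ N₂ n (κ n) (ε n)) ∧
    Filter.Tendsto (fun n => (κ n : ℝ) / n) Filter.atTop (nhds R) ∧
    Filter.Tendsto ε Filter.atTop (nhds 0)

/-- The EPR distribution capacity `E(N₁, N₂)`, the supremum (in the extended reals) of the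
achievable rates. -/
def capacity (N₁ : SuperOp S₁ A₁) (N₂ : SuperOp S₂ A₂) : EReal :=
  ⨆ (R : ℝ) (_ : IsAchievable N₁ N₂ R), (R : EReal)

/-! ### Amplitude damping and multi-rail encoding -/

/-- The Kraus operators of the generalized amplitude damping channel. -/
def gadcKraus (γ T : ℝ) : Fin 4 → Matrix (Fin 2) (Fin 2) ℂ :=
  ![(√(1 - T) : ℂ) • !![1, 0; 0, (√(1 - γ) : ℂ)],
    !![0, (√(γ * (1 - T)) : ℂ); 0, 0],
    (√T : ℂ) • !![(√(1 - γ) : ℂ), 0; 0, 1],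
    !![0, 0; (√(γ * T) : ℂ), 0]]

/-- The generalized amplitude damping channel with damping parameter `γ`, thermal parameter `T`. -/
def gadc (γ T : ℝ) : SuperOp (Fin 2) (Fin 2) := krausMap (gadcKraus γ T)

/-- The amplitude damping channel `𝒜_γ` (zero temperature). -/
def ampDamp (γ : ℝ) : SuperOp (Fin 2) (Fin 2) := gadc γ 0

/-- `k` qubits. -/
abbrev Rails (k : ℕ) : Type := Fin k → Fin 2

/-- The bit string with a single `1`, at position `i`. -/
def oneHot {k : ℕ} (i : Fin k) : Rails k := fun j => if j = i then 1 else 0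

/-- `|ψ_k⟩ = (1/√k) ∑ᵢ |eᵢ⟩|eᵢ⟩`, with `eᵢ` the bit string with a single `1`, at position `i`. -/
def railVec (k : ℕ) : Rails k × Rails k → ℂ := fun p =>
  ((1 / √k : ℝ) : ℂ) * ∑ i : Fin k, if p = (oneHot i, oneHot i) then 1 else 0

/-- The `k`-rail state `ψ_k = |ψ_k⟩⟨ψ_k|`. -/
def railState (k : ℕ) : Op (Rails k × Rails k) := pureState (railVec k)

/-- The projection onto the one-particle sector of `k` qubits, `∑ᵢ |eᵢ⟩⟨eᵢ|`. -/
def oneParticle (k : ℕ) : Op (Rails k) := ∑ i : Fin k, Matrix.single (oneHot i) (oneHot i) 1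

/-- `ρ = (𝒜_{γ₁}^{⊗ k} ⊗ 𝒜_{γ₂}^{⊗ k})(ψ_k)`. -/
def railOutput (γ₁ γ₂ : ℝ) (k : ℕ) : Op (Rails k × Rails k) :=
  tensorMap (tensorPow k (ampDamp γ₁)) (tensorPow k (ampDamp γ₂)) (railState k)

/-- `ρ` is a maximally entangled state of Schmidt rank `k`. -/
def IsMaxEntangled {A B : Type} [Fintype A] [Fintype B] (k : ℕ) (ρ : Op (A × B)) : Prop :=
  ∃ (u : Fin k → A → ℂ) (v : Fin k → B → ℂ),
    (∀ i j, dotProduct (star (u i)) (u j) = if i = j then 1 else 0) ∧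
    (∀ i j, dotProduct (star (v i)) (v j) = if i = j then 1 else 0) ∧
    ρ = pureState fun p => ((1 / √k : ℝ) : ℂ) * ∑ i, u i p.1 * v i p.2

/-- For `m` blocks of `k` qubits, the projection onto the event that the one-particle test succeeds
on the blocks in `s` and fails on the others. -/
def sectorProj (m k : ℕ) (s : Finset (Fin m)) : Op (Fin m → Rails k) :=
  Matrix.of fun x y =>
    ∏ b, (if b ∈ s then oneParticle k else 1 - oneParticle k) (x b) (y b)

/-- The block string that is `x` on the blocks in `G` and `r` on the others. -/
def glue {m : ℕ} {X : Type} (G : Finset (Fin m)) (x : {b // b ∈ G} → X)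
    (r : {b // b ∉ G} → X) : Fin m → X :=
  fun b => if h : b ∈ G then x ⟨b, h⟩ else r ⟨b, h⟩

/-- Keep the blocks in `G` of both parties and discard (trace out) all the others. -/
def keepBlocks {m : ℕ} {X : Type} [Fintype X] (G : Finset (Fin m))
    (ρ : Op ((Fin m → X) × (Fin m → X))) :
    Op (({b // b ∈ G} → X) × ({b // b ∈ G} → X)) :=
  Matrix.of fun p q => ∑ r : {b // b ∉ G} → X, ∑ r' : {b // b ∉ G} → X,
    ρ (glue G p.1 r, glue G p.2 r') (glue G q.1 r, glue G q.2 r')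

/-- Post-selection: each receiver tests each of the `m` blocks for the one-particle sector; with `s`
and `t` the sets of blocks on which the first and the second receiver succeed, only the blocks in
`s ∩ t` are kept, and they are processed by `K (s ∩ t)`. -/
def postSelect {m k : ℕ} {A' B' : Type}
    (K : ∀ G : Finset (Fin m),
      SuperOp (({b // b ∈ G} → Rails k) × ({b // b ∈ G} → Rails k)) (A' × B'))
    (ρ : Op ((Fin m → Rails k) × (Fin m → Rails k))) : Op (A' × B') :=
  ∑ s : Finset (Fin m), ∑ t : Finset (Fin m), K (s ∩ t) (keepBlocks (s ∩ t)
    ((sectorProj m k s ⊗ₖ sectorProj m k t) * ρ * (sectorProj m k s ⊗ₖ sectorProj m k t)))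

/-- `m` copies of `ψ_k` are sent through `m * k` uses of each of the two amplitude damping channels;
post-selecting on the one-particle sector and LOCC on the surviving blocks produce `κ` EPR pairs
with error at most `ε`. -/
def HasRailCode (γ₁ γ₂ : ℝ) (k m κ : ℕ) (ε : ℝ) : Prop :=
  ∃ K : ∀ G : Finset (Fin m), SuperOp (({b // b ∈ G} → Rails k) × ({b // b ∈ G} → Rails k))
      ((Fin κ → Fin 2) × (Fin κ → Fin 2)),
    (∀ G, IsLOCC _ _ _ _ (K G)) ∧
    traceNorm (copies κ epr - postSelect K
      (tensorMap (tensorPow m (tensorPow k (ampDamp γ₁))) (tensorPow m (tensorPow k (ampDamp γ₂)))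
        (copies m (railState k)))) ≤ ε

/-- `k`-rail encoding with post-selection on the one-particle sector achieves `R` EPR pairs per
channel use. -/
def IsRailAchievable (γ₁ γ₂ : ℝ) (k : ℕ) (R : ℝ) : Prop :=
  ∃ (κ : ℕ → ℕ) (ε : ℕ → ℝ), (∀ m, 1 ≤ m → HasRailCode γ₁ γ₂ k m (κ m) (ε m)) ∧
    Filter.Tendsto (fun m => (κ m : ℝ) / (m * k)) Filter.atTop (nhds R) ∧
    Filter.Tendsto ε Filter.atTop (nhds 0)

/-- The multi-rail rate `(1 - γ₁)(1 - γ₂) log₂ k / k`. -/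
def railRate (γ₁ γ₂ : ℝ) (k : ℕ) : ℝ := (1 - γ₁) * (1 - γ₂) * Real.logb 2 k / k

end

end EPRDist

open EPRDist

namespace EPRDist

noncomputable section

/-! ### Superoperators in coordinates -/

/-! Amplitude damping never creates a particle. If a receiver finds exactly one particle in a block,
that particle was neither lost nor moved to another rail, and every |e_i⟩ has picked up the same
amplitude √(1-γ). Hence the part of the output that passes both tests is ψ_k times the scalar p =
(1-γ₁)(1-γ₂) (`oneParticle_sandwich`): the loss costs probability, but no fidelity.

For m blocks everything factorizes, so the receivers hold a classical mixture, over the pairs (s, t)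
of successful sets, of |s ∩ t| perfect copies of ψ_k (`keepBlocks_sector`, `postSelect_copies`). N
copies form a maximally entangled state of rank k^N, and LOCC turns it exactly into κ EPR pairs as
soon as 2^κ ≤ k^N (`exists_locc_rail_to_epr`). The only error is therefore the probability that too
few blocks survive (`hasRailCode_of_prob`). The number of survivors is binomial with mean mp; a
Chernoff bound (`sum_sectorProbRe_le`) with slack m^(2/3) makes this probability vanish without
reducing the rate (`hasRailCode_railYield`, `tendsto_railYield`).

For the capacity, the tests and the discarding are themselves rounds of LOCC, and the fewer than k
channel uses that do not fill a block are fed |0⟩ and ignored (`HasRailCode.hasEPRCode`). The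
optimum k = 3 comes from log x / x decreasing beyond e < 3, with k = 1, 2 compared directly
(`logb_div_self_le`). -/

lemma superOp_apply {A B : Type} [Fintype A] [DecidableEq A] (Φ : SuperOp A B) (X : Op A)
    (i j : B) : Φ X i j = ∑ a, ∑ b, X a b * Φ (Matrix.single a b 1) i j := by
  conv_lhs => rw [Matrix.matrix_eq_sum_single X]
  simp only [map_sum, Matrix.sum_apply]
  refine Finset.sum_congr rfl fun a _ => Finset.sum_congr rfl fun b _ => ?_
  have : Matrix.single a b (X a b) = X a b • Matrix.single a b (1 : ℂ) := by
    rw [Matrix.smul_single, smul_eq_mul, mul_one]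
  rw [this, map_smul, Matrix.smul_apply, smul_eq_mul]

lemma superOp_ext {A B : Type} [Fintype A] [DecidableEq A] {Φ Ψ : SuperOp A B}
    (h : ∀ a b i j, Φ (Matrix.single a b 1) i j = Ψ (Matrix.single a b 1) i j) : Φ = Ψ := by
  refine LinearMap.ext fun X => ?_
  ext i j
  rw [superOp_apply Φ, superOp_apply Ψ]
  simp only [h]

lemma onLeft_apply {A B : Type} (C : Type) (Φ : SuperOp A B) (ρ : Op (A × C)) (p q : B × C) :
    onLeft C Φ ρ p q = Φ (Matrix.of fun i j => ρ (i, p.2) (j, q.2)) p.1 q.1 := rfl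

lemma onRight_apply {A B : Type} (C : Type) (Φ : SuperOp A B) (ρ : Op (C × A)) (p q : C × B) :
    onRight C Φ ρ p q = Φ (Matrix.of fun i j => ρ (p.1, i) (q.1, j)) p.2 q.2 := rfl

lemma tensorMap_apply {A B C D : Type} [Fintype A] [DecidableEq A] [Fintype C] [DecidableEq C]
    (Φ : SuperOp A B) (Ψ : SuperOp C D) (ρ : Op (A × C)) (p q : B × D) :
    tensorMap Φ Ψ ρ p q = ∑ c, ∑ c', ∑ a, ∑ a', ρ (a, c) (a', c') *
      Φ (Matrix.single a a' 1) p.1 q.1 * Ψ (Matrix.single c c' 1) p.2 q.2 := by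
  rw [tensorMap, LinearMap.comp_apply, onRight_apply, superOp_apply]
  refine Finset.sum_congr rfl fun c _ => Finset.sum_congr rfl fun c' _ => ?_
  rw [Matrix.of_apply, onLeft_apply, superOp_apply]
  simp only [Finset.sum_mul, Matrix.of_apply]

/-- Both orders expand into the same fourfold sum over matrix units. This commutation is what makes
`tensorMap` multiplicative under composition. -/
lemma onRight_onLeft_comm {A B C D : Type} [Fintype A] [DecidableEq A] [Fintype C] [DecidableEq C]
    (Φ : SuperOp A B) (Ψ : SuperOp C D) :
    (onRight B Ψ).comp (onLeft C Φ) = (onLeft D Φ).comp (onRight A Ψ) := by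
  refine LinearMap.ext fun ρ => ?_
  ext p q
  have h := tensorMap_apply Φ Ψ ρ p q
  rw [tensorMap] at h
  rw [h, LinearMap.comp_apply, onLeft_apply, superOp_apply]
  simp only [Matrix.of_apply, onRight_apply, superOp_apply Ψ (Matrix.of _), Finset.sum_mul]
  simp only [← Fintype.sum_prod_type']
  refine Fintype.sum_equiv ⟨fun x => (x.2.2.1, x.2.2.2, x.1, x.2.1),
    fun x => (x.2.2.1, x.2.2.2, x.1, x.2.1), fun _ => rfl, fun _ => rfl⟩ _ _ fun x => ?_
  simp only [Equiv.coe_fn_mk]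
  ring

lemma tensorMap_comp {A B C A' B' C' : Type} [Fintype B] [DecidableEq B] [Fintype A']
    [DecidableEq A'] [Fintype B'] [DecidableEq B'] (Φ : SuperOp A B) (Φ' : SuperOp B C)
    (Ψ : SuperOp A' B') (Ψ' : SuperOp B' C') :
    tensorMap (Φ'.comp Φ) (Ψ'.comp Ψ) = (tensorMap Φ' Ψ').comp (tensorMap Φ Ψ) := by
  have h1 : onLeft A' (Φ'.comp Φ) = (onLeft A' Φ').comp (onLeft A' Φ) := rfl
  have h2 : onRight C (Ψ'.comp Ψ) = (onRight C Ψ').comp (onRight C Ψ) := rfl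
  rw [tensorMap, tensorMap, tensorMap, h1, h2, LinearMap.comp_assoc, LinearMap.comp_assoc,
    ← LinearMap.comp_assoc (onLeft A' Φ), onRight_onLeft_comm Φ' Ψ, LinearMap.comp_assoc]

lemma tensorPow_single {A B : Type} [Fintype A] [DecidableEq A] (n : ℕ) (Φ : SuperOp A B)
    (k l : Fin n → A) (i j : Fin n → B) :
    tensorPow n Φ (Matrix.single k l 1) i j =
      ∏ t, Φ (Matrix.single (k t) (l t) 1) (i t) (j t) := by
  change ∑ k', ∑ l', Matrix.single k l (1 : ℂ) k' l' *
    ∏ t, Φ (Matrix.single (k' t) (l' t) 1) (i t) (j t) = _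
  rw [Finset.sum_eq_single k, Finset.sum_eq_single l]
  · simp
  · intro b _ hb
    simp [hb.symm]
  · simp
  · intro b _ hb
    simp [hb.symm]
  · simp

/-- Copies of a bipartite operator indexed by an arbitrary finite type. -/
def prodOp (ι : Type) [Fintype ι] {A B : Type} (ρ : Op (A × B)) : Op ((ι → A) × (ι → B)) :=
  Matrix.of fun p q => ∏ t, ρ (p.1 t, p.2 t) (q.1 t, q.2 t)

lemma copies_eq_prodOp {A B : Type} (n : ℕ) (ρ : Op (A × B)) : copies n ρ = prodOp (Fin n) ρ := rfl

/-- Distributivity: a product over copies of sums over matrix units is a sum over strings of matrix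
units. It reduces m blocks to one. -/
lemma tensorMap_tensorPow_copies {A B C D : Type} [Fintype A] [DecidableEq A] [Fintype C]
    [DecidableEq C] (n : ℕ) (Φ : SuperOp A B) (Ψ : SuperOp C D) (ρ : Op (A × C)) :
    tensorMap (tensorPow n Φ) (tensorPow n Ψ) (copies n ρ) = copies n (tensorMap Φ Ψ ρ) := by
  ext p q
  rw [tensorMap_apply]
  change _ = ∏ t, tensorMap Φ Ψ ρ (p.1 t, p.2 t) (q.1 t, q.2 t)
  simp only [tensorMap_apply, tensorPow_single, Finset.prod_univ_sum, Fintype.piFinset_univ,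
    Finset.prod_mul_distrib]
  rfl

/-- By linearity it is enough to treat matrix units, where the trace is the product of the traces of
the factors. -/
lemma trace_tensorPow {A B : Type} [Fintype A] [DecidableEq A] [Fintype B]
    (n : ℕ) (Φ : SuperOp A B) (hΦ : ∀ X, (Φ X).trace = X.trace) (X : Op (Fin n → A)) :
    (tensorPow n Φ X).trace = X.trace := by
  classical
  have h (k l : Fin n → A) : ∑ i, tensorPow n Φ (Matrix.single k l 1) i i =
      if k = l then 1 else 0 := by
    simp only [tensorPow_single]
    have := Finset.prod_univ_sum (fun _ : Fin n => (Finset.univ : Finset B))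
      (fun t i => Φ (Matrix.single (k t) (l t) 1) i i)
    rw [Fintype.piFinset_univ] at this
    rw [← this]
    have h2 (t : Fin n) : ∑ i, Φ (Matrix.single (k t) (l t) 1) i i = if k t = l t then 1 else 0 := by
      have := hΦ (Matrix.single (k t) (l t) 1)
      simp only [Matrix.trace, Matrix.diag] at this
      rw [this, Finset.sum_eq_single (k t)]
      · simp [Matrix.single_apply, eq_comm]
      · intro b _ hb
        simp [hb.symm]
      · simp
    simp only [h2, Finset.prod_ite_zero]
    simp [funext_iff]
  simp only [Matrix.trace, Matrix.diag]
  calc ∑ i, tensorPow n Φ X i i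
      = ∑ i, ∑ k, ∑ l, X k l * tensorPow n Φ (Matrix.single k l 1) i i := by
        simp only [superOp_apply (tensorPow n Φ) X]
    _ = ∑ k, ∑ l, X k l * ∑ i, tensorPow n Φ (Matrix.single k l 1) i i := by
        rw [Finset.sum_comm]
        refine Finset.sum_congr rfl fun k _ => ?_
        rw [Finset.sum_comm]
        simp only [Finset.mul_sum]
    _ = ∑ k, X k k := by simp [h]

lemma trace_onLeft {A B C : Type} [Fintype A] [Fintype B] [Fintype C] (Φ : SuperOp A B)
    (hΦ : ∀ X, (Φ X).trace = X.trace) (ρ : Op (A × C)) : (onLeft C Φ ρ).trace = ρ.trace := by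
  simp only [Matrix.trace, Matrix.diag, Fintype.sum_prod_type_right, onLeft_apply]
  refine Finset.sum_congr rfl fun c _ => ?_
  exact hΦ (Matrix.of fun i j => ρ (i, c) (j, c))

lemma trace_onRight {A B C : Type} [Fintype A] [Fintype B] [Fintype C] (Φ : SuperOp A B)
    (hΦ : ∀ X, (Φ X).trace = X.trace) (ρ : Op (C × A)) : (onRight C Φ ρ).trace = ρ.trace := by
  simp only [Matrix.trace, Matrix.diag, Fintype.sum_prod_type, onRight_apply]
  refine Finset.sum_congr rfl fun c _ => ?_
  exact hΦ (Matrix.of fun i j => ρ (c, i) (c, j))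

lemma trace_tensorMap {A B C D : Type} [Fintype A] [Fintype B] [Fintype C] [Fintype D]
    (Φ : SuperOp A B) (Ψ : SuperOp C D) (hΦ : ∀ X, (Φ X).trace = X.trace)
    (hΨ : ∀ X, (Ψ X).trace = X.trace) (ρ : Op (A × C)) :
    (tensorMap Φ Ψ ρ).trace = ρ.trace := by
  rw [tensorMap, LinearMap.comp_apply, trace_onRight Ψ hΨ, trace_onLeft Φ hΦ]

lemma trace_prodOp (ι : Type) [Fintype ι] [DecidableEq ι] {A B : Type} [Fintype A] [Fintype B]
    (ρ : Op (A × B)) : (prodOp ι ρ).trace = ρ.trace ^ Fintype.card ι := by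
  have h := Finset.prod_univ_sum (fun _ : ι => (Finset.univ : Finset (A × B)))
      (fun _ p => ρ p p)
  rw [Fintype.piFinset_univ] at h
  simp only [Finset.prod_const, Finset.card_univ] at h
  simp only [Matrix.trace, Matrix.diag]
  rw [h]
  exact (Fintype.sum_equiv (Equiv.arrowProdEquivProdArrow ι (fun _ => A) (fun _ => B)) _ _ fun x => rfl).symm

/-! ### Maps that select, weigh and sum blocks -/

/-- The completely positive map `ρ ↦ ∑ᵣ Kᵣ ρ Kᵣᴴ` with `Kᵣ = ∑ₓ d r x |x⟩⟨f r x|`. -/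
def selectMap {R X A : Type} [Fintype R] (f : R → X → A) (d : R → X → ℂ) : SuperOp A X where
  toFun ρ := Matrix.of fun x y => ∑ r, d r x * ρ (f r x) (f r y) * star (d r y)
  map_add' ρ σ := by
    ext x y
    simp [mul_add, add_mul, Finset.sum_add_distrib]
  map_smul' c ρ := by
    ext x y
    simp only [Matrix.of_apply, Matrix.smul_apply, smul_eq_mul, Finset.mul_sum, RingHom.id_apply]
    exact Finset.sum_congr rfl fun _ _ => by ring

lemma selectMap_apply {R X A : Type} [Fintype R] (f : R → X → A) (d : R → X → ℂ) (ρ : Op A)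
    (x y : X) : selectMap f d ρ x y = ∑ r, d r x * ρ (f r x) (f r y) * star (d r y) := rfl

lemma posSemidef_weighted_submatrix {X A : Type} [Finite X] {ρ : Op A} (hρ : ρ.PosSemidef)
    (f : X → A) (d : X → ℂ) :
    (Matrix.of fun x y => d x * ρ (f x) (f y) * star (d y)).PosSemidef := by
  classical
  have := Fintype.ofFinite X
  have h := (hρ.submatrix f).mul_mul_conjTranspose_same (Matrix.diagonal d)
  convert h using 1
  ext x y
  simp [Matrix.diagonal_conjTranspose]

lemma posSemidef_onRight_selectMap {R X A C : Type} [Fintype R] [Finite X] [Finite C]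
    (f : R → X → A) (d : R → X → ℂ) {ρ : Op (C × A)} (hρ : ρ.PosSemidef) :
    (onRight C (selectMap f d) ρ).PosSemidef := by
  have h : onRight C (selectMap f d) ρ = ∑ r, Matrix.of fun p q : C × X =>
      d r p.2 * ρ (p.1, f r p.2) (q.1, f r q.2) * star (d r q.2) := by
    ext p q
    rw [Matrix.sum_apply]
    rfl
  rw [h]
  exact Matrix.posSemidef_sum _ fun r _ =>
    posSemidef_weighted_submatrix hρ (fun p : C × X => (p.1, f r p.2)) (fun p => d r p.2)

lemma posSemidef_onLeft_selectMap {R X A C : Type} [Fintype R] [Finite X] [Finite C]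
    (f : R → X → A) (d : R → X → ℂ) {ρ : Op (A × C)} (hρ : ρ.PosSemidef) :
    (onLeft C (selectMap f d) ρ).PosSemidef := by
  have h : onLeft C (selectMap f d) ρ = ∑ r, Matrix.of fun p q : X × C =>
      d r p.1 * ρ (f r p.1, p.2) (f r q.1, q.2) * star (d r q.1) := by
    ext p q
    rw [Matrix.sum_apply]
    rfl
  rw [h]
  exact Matrix.posSemidef_sum _ fun r _ =>
    posSemidef_weighted_submatrix hρ (fun p : X × C => (f r p.1, p.2)) (fun p => d r p.1)

/-- For these Kraus operators ∑ KᴴK is automatically diagonal, since K sends each ⟨f r x| to a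
different |x⟩. Completeness is thus one scalar equation per basis vector a, which is the hypothesis
`h`. Every instrument below is of this kind. -/
lemma isInstrument_selectMap {A Y : Type} [Fintype A] [DecidableEq A] [Fintype Y] {C R : Y → Type}
    [∀ y, Fintype (C y)] [∀ y, Fintype (R y)] (f : ∀ y, R y → C y → A) (d : ∀ y, R y → C y → ℂ)
    (h : ∀ a, ∑ y, ∑ r, ∑ x, (if f y r x = a then d y r x * star (d y r x) else 0) = 1) :
    IsInstrument fun y => selectMap (f y) (d y) := by
  refine ⟨fun y n ρ hρ => posSemidef_onRight_selectMap _ _ hρ, fun ρ => ?_⟩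
  have h1 (y : Y) : (selectMap (f y) (d y) ρ).trace =
      ∑ a, ρ a a * ∑ r, ∑ x, (if f y r x = a then d y r x * star (d y r x) else 0) := by
    simp only [Matrix.trace, Matrix.diag, selectMap_apply, Finset.mul_sum, mul_ite, mul_zero]
    rw [Finset.sum_comm]
    conv_rhs => rw [Finset.sum_comm]
    refine Finset.sum_congr rfl fun r _ => ?_
    conv_rhs => rw [Finset.sum_comm]
    refine Finset.sum_congr rfl fun x _ => ?_
    rw [Finset.sum_ite_eq]
    simp only [Finset.mem_univ, if_true]
    ring
  simp only [h1]
  rw [Finset.sum_comm]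
  simp only [← Finset.mul_sum, h, mul_one]
  rfl

lemma trace_selectMap {A X R : Type} [Fintype A] [DecidableEq A] [Fintype X] [Fintype R]
    (f : R → X → A) (d : R → X → ℂ)
    (h : ∀ a, ∑ r, ∑ x, (if f r x = a then d r x * star (d r x) else 0) = 1) (ρ : Op A) :
    (selectMap f d ρ).trace = ρ.trace := by
  have := (isInstrument_selectMap (Y := Unit) (fun _ => f) (fun _ => d) (by simpa using h)).2 ρ
  simpa using this

/-! ### The trace norm of a difference of orthogonal positive operators -/

/-- The cross terms vanish, so (X - Y)² = (X + Y)², and X + Y is the positive square root. -/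
lemma traceNorm_sub_of_mul_eq_zero {A : Type} [Fintype A] [DecidableEq A] {X Y : Op A}
    (hX : X.PosSemidef) (hY : Y.PosSemidef) (h : X * Y = 0) :
    traceNorm (X - Y) = (X.trace + Y.trace).re := by
  have h' : Y * X = 0 := by
    have := congrArg Matrix.conjTranspose h
    rwa [Matrix.conjTranspose_mul, hX.isHermitian.eq, hY.isHermitian.eq,
      Matrix.conjTranspose_zero] at this
  open scoped MatrixOrder in
  have hs : CFC.abs (X - Y) = X + Y := by
    have h2 : star (X - Y) * (X - Y) = (X + Y) * (X + Y) := by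
      rw [Matrix.star_eq_conjTranspose, Matrix.conjTranspose_sub, hX.isHermitian.eq,
        hY.isHermitian.eq]
      simp only [sub_mul, mul_sub, add_mul, mul_add, h, h']
      abel
    rw [CFC.abs, h2, CFC.sqrt_mul_self _ (Matrix.nonneg_iff_posSemidef.mpr (hX.add hY))]
  rw [traceNorm, hs, Matrix.trace_add]

/-! ### One block of rails -/

lemma tensorMap_single {A B C D : Type} [DecidableEq A] [DecidableEq C]
    (Φ : SuperOp A B) (Ψ : SuperOp C D) (a a' : A) (c c' : C) (p q : B × D) :
    tensorMap Φ Ψ (Matrix.single (a, c) (a', c') 1) p q =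
      Φ (Matrix.single a a' 1) p.1 q.1 * Ψ (Matrix.single c c' 1) p.2 q.2 := by
  rw [tensorMap, LinearMap.comp_apply, onRight_apply]
  have h (i j : C) : onLeft C Φ (Matrix.single (a, c) (a', c') 1) (p.1, i) (q.1, j) =
      (Φ (Matrix.single a a' 1) p.1 q.1) * Matrix.single c c' (1 : ℂ) i j := by
    rw [onLeft_apply]
    have : (Matrix.of fun x y => Matrix.single (a, c) (a', c') (1 : ℂ) (x, i) (y, j)) =
        Matrix.single c c' (1 : ℂ) i j • Matrix.single a a' (1 : ℂ) := by
      ext x y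
      simp only [Matrix.of_apply, Matrix.single_apply, Matrix.smul_apply, smul_eq_mul,
        Prod.mk.injEq, ← ite_and, mul_ite, mul_one, mul_zero]
      congr 1
      grind
    rw [this, map_smul, Matrix.smul_apply, smul_eq_mul, mul_comm]
  have h2 : (Matrix.of fun i j => onLeft C Φ (Matrix.single (a, c) (a', c') 1) (p.1, i) (q.1, j)) =
      (Φ (Matrix.single a a' 1) p.1 q.1) • Matrix.single c c' (1 : ℂ) := by
    ext i j
    exact h i j
  rw [h2, map_smul, Matrix.smul_apply, smul_eq_mul]

lemma ampDamp_apply {γ : ℝ} (h : γ ∈ Set.Icc (0 : ℝ) 1) (X : Op (Fin 2)) :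
    ampDamp γ X = !![X 0 0 + γ * X 1 1, (√(1 - γ) : ℂ) * X 0 1;
      (√(1 - γ) : ℂ) * X 1 0, (1 - γ : ℝ) * X 1 1] := by
  have h1 : ((√(1 - γ) : ℝ) : ℂ) * ((√(1 - γ) : ℝ) : ℂ) = ((1 - γ : ℝ) : ℂ) := by
    rw [← Complex.ofReal_mul, Real.mul_self_sqrt (by linarith [h.2])]
  have h2 : ((√γ : ℝ) : ℂ) * ((√γ : ℝ) : ℂ) = (γ : ℂ) := by
    rw [← Complex.ofReal_mul, Real.mul_self_sqrt h.1]
  have e0 : gadcKraus γ 0 0 = !![1, 0; 0, (√(1 - γ) : ℂ)] := by simp [gadcKraus]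
  have e1 : gadcKraus γ 0 1 = !![0, (√γ : ℂ); 0, 0] := by simp [gadcKraus]
  have e2 : gadcKraus γ 0 2 = 0 := by simp [gadcKraus]
  have e3 : gadcKraus γ 0 3 = 0 := by
    ext i j
    fin_cases i <;> fin_cases j <;> simp [gadcKraus]
  rw [ampDamp, gadc]
  change ∑ i, gadcKraus γ 0 i * X * (gadcKraus γ 0 i).conjTranspose = _
  rw [Fin.sum_univ_four, e0, e1, e2, e3, Matrix.zero_mul, Matrix.zero_mul, add_zero, add_zero]
  ext i j
  simp only [Matrix.add_apply, Matrix.mul_apply, Fin.sum_univ_two, Matrix.conjTranspose_apply]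
  fin_cases i <;> fin_cases j <;> simp
  · linear_combination (X 1 1) * h2
  · ring
  · push_cast at h1
    linear_combination (X 1 1) * h1

lemma trace_ampDamp {γ : ℝ} (h : γ ∈ Set.Icc (0 : ℝ) 1) (X : Op (Fin 2)) :
    (ampDamp γ X).trace = X.trace := by
  rw [ampDamp_apply h]
  simp [Matrix.trace, Fin.sum_univ_two]
  ring

/-- Gives nonnegative test probabilities entry by entry, without complete positivity of tensor
powers of the channel. -/
lemma ampDamp_single_diag_nonneg {γ : ℝ} (h : γ ∈ Set.Icc (0 : ℝ) 1) (a b i : Fin 2) :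
    0 ≤ ampDamp γ (Matrix.single a b 1) i i := by
  have h0 : (0 : ℂ) ≤ γ := by exact_mod_cast h.1
  have h1 : (0 : ℂ) ≤ 1 - γ := by exact_mod_cast sub_nonneg.mpr h.2
  rw [ampDamp_apply h]
  fin_cases a <;> fin_cases b <;> fin_cases i <;> simp [h0]
  simpa using h1

lemma oneHot_injective {k : ℕ} : Function.Injective (oneHot : Fin k → Rails k) := by
  intro i j h
  have := congrFun h i
  simpa [oneHot] using this

/-- The transition amplitudes of the damped one-particle sector to itself. -/
lemma tensorPow_ampDamp_oneHot {γ : ℝ} (h : γ ∈ Set.Icc (0 : ℝ) 1) {k : ℕ} (a b i j : Fin k) :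
    tensorPow k (ampDamp γ) (Matrix.single (oneHot a) (oneHot b) 1) (oneHot i) (oneHot j) =
      if a = i ∧ b = j then ((1 - γ : ℝ) : ℂ) else 0 := by
  rw [tensorPow_single]
  split_ifs with hab
  · obtain ⟨rfl, rfl⟩ := hab
    have h1 : ((√(1 - γ) : ℝ) : ℂ) * ((√(1 - γ) : ℝ) : ℂ) = ((1 - γ : ℝ) : ℂ) := by
      rw [← Complex.ofReal_mul, Real.mul_self_sqrt (by linarith [h.2])]
    -- An unchanged entry loses √(1-γ) for each of its row and column bits that is 1. The product
    -- over rails thus contains one such factor from the row string and one from the column string.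
    have h2 (x y : Fin 2) : ampDamp γ (Matrix.single x y 1) x y =
        (if x = 1 then ((√(1 - γ) : ℝ) : ℂ) else 1) *
          (if y = 1 then ((√(1 - γ) : ℝ) : ℂ) else 1) := by
      rw [ampDamp_apply h]
      fin_cases x <;> fin_cases y <;> simp
      rw [h1]
      simp
    simp only [h2, Finset.prod_mul_distrib]
    simp [oneHot, h1]
  · by_cases ha : a = i
    · have hb : j ≠ b := fun hb => hab ⟨ha, hb.symm⟩
      -- At rail j the column bit would go from 0 to 1, which damping forbids; below, the row bit at
      -- rail i plays this role.
      refine Finset.prod_eq_zero (Finset.mem_univ j) ?_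
      rw [ampDamp_apply h]
      generalize oneHot a j = x
      generalize oneHot i j = y
      fin_cases x <;> fin_cases y <;> simp [oneHot, hb]
    · have ha : i ≠ a := fun ha' => ha ha'.symm
      refine Finset.prod_eq_zero (Finset.mem_univ i) ?_
      rw [ampDamp_apply h]
      generalize oneHot b i = x
      generalize oneHot j i = y
      fin_cases x <;> fin_cases y <;> simp [oneHot, ha]

lemma railVec_oneHot {k : ℕ} (i : Fin k) (y : Rails k) :
    railVec k (oneHot i, y) = if y = oneHot i then ((1 / √k : ℝ) : ℂ) else 0 := by
  rw [railVec, Finset.sum_eq_single i]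
  · simp
  · intro j _ hj
    simp [oneHot_injective.eq_iff, hj.symm]
  · simp

lemma railVec_eq_zero {k : ℕ} {x : Rails k} (hx : ∀ i, x ≠ oneHot i) (y : Rails k) :
    railVec k (x, y) = 0 := by
  simp [railVec, hx]

lemma railState_apply {k : ℕ} (p q : Rails k × Rails k) :
    railState k p q = railVec k p * star (railVec k q) := rfl

lemma inv_sqrt_mul_star (k : ℕ) :
    ((1 / √k : ℝ) : ℂ) * star ((1 / √k : ℝ) : ℂ) = (k : ℂ)⁻¹ := by
  simp only [Complex.star_def, Complex.conj_ofReal]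
  rw [← Complex.ofReal_mul, div_mul_div_comm, Real.mul_self_sqrt (Nat.cast_nonneg k)]
  simp

lemma railState_oneHot {k : ℕ} (i j : Fin k) (y y' : Rails k) :
    railState k (oneHot i, y) (oneHot j, y') =
      if y = oneHot i ∧ y' = oneHot j then (k : ℂ)⁻¹ else 0 := by
  rw [railState_apply, railVec_oneHot, railVec_oneHot, ← inv_sqrt_mul_star]
  by_cases h1 : y = oneHot i <;> by_cases h2 : y' = oneHot j <;> simp [h1, h2]

lemma railState_eq_sum (k : ℕ) : railState k =
    ∑ i, ∑ j, (k : ℂ)⁻¹ • Matrix.single (oneHot i, oneHot i) (oneHot j, oneHot j) (1 : ℂ) := by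
  ext p q
  rw [railState_apply, railVec, railVec, star_mul', mul_mul_mul_comm, inv_sqrt_mul_star, star_sum,
    Finset.sum_mul_sum]
  simp only [Matrix.sum_apply, Matrix.smul_apply, smul_eq_mul, Finset.mul_sum, Matrix.single_apply]
  refine Finset.sum_congr rfl fun i _ => Finset.sum_congr rfl fun j _ => ?_
  by_cases h1 : p = (oneHot i, oneHot i) <;> by_cases h2 : q = (oneHot j, oneHot j) <;>
    simp [h1, h2, eq_comm]

lemma railOutput_apply (γ₁ γ₂ : ℝ) (k : ℕ) (p q : Rails k × Rails k) :
    railOutput γ₁ γ₂ k p q = ∑ i, ∑ j, (k : ℂ)⁻¹ *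
      (tensorPow k (ampDamp γ₁) (Matrix.single (oneHot i) (oneHot j) 1) p.1 q.1 *
        tensorPow k (ampDamp γ₂) (Matrix.single (oneHot i) (oneHot j) 1) p.2 q.2) := by
  rw [railOutput, railState_eq_sum]
  simp only [map_sum, map_smul, Matrix.sum_apply, Matrix.smul_apply, tensorMap_single, smul_eq_mul]

lemma railOutput_diag_nonneg {γ₁ γ₂ : ℝ} (h₁ : γ₁ ∈ Set.Icc (0 : ℝ) 1)
    (h₂ : γ₂ ∈ Set.Icc (0 : ℝ) 1) (k : ℕ) (p : Rails k × Rails k) :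
    0 ≤ railOutput γ₁ γ₂ k p p := by
  rw [railOutput_apply]
  simp only [tensorPow_single]
  refine Finset.sum_nonneg fun i _ => Finset.sum_nonneg fun j _ => mul_nonneg ?_ (mul_nonneg ?_ ?_)
  · have : (0 : ℝ) ≤ (k : ℝ)⁻¹ := by positivity
    rw [← Complex.ofReal_natCast, ← Complex.ofReal_inv]
    exact_mod_cast this
  · exact Finset.prod_nonneg fun t _ => ampDamp_single_diag_nonneg h₁ _ _ _
  · exact Finset.prod_nonneg fun t _ => ampDamp_single_diag_nonneg h₂ _ _ _

lemma trace_railState {k : ℕ} (hk : 1 ≤ k) : (railState k).trace = 1 := by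
  have hk' : (k : ℂ) ≠ 0 := by exact_mod_cast (by omega : k ≠ 0)
  have (i j : Fin k) : (Matrix.single (oneHot i, oneHot i) (oneHot j, oneHot j) (1 : ℂ)).trace =
      if i = j then 1 else 0 := by
    split_ifs with h
    · subst h
      exact Matrix.trace_single_eq_same _ _
    · exact Matrix.trace_single_eq_of_ne _ _ _ (by simp [oneHot_injective.eq_iff, h])
  rw [railState_eq_sum]
  simp only [Matrix.trace_sum, Matrix.trace_smul, this]
  simp [hk']

/-- The indicator function of the one-particle sector. -/
def hot {k : ℕ} (x : Rails k) : ℂ := if ∃ i, x = oneHot i then 1 else 0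

lemma hot_oneHot {k : ℕ} (i : Fin k) : hot (oneHot i : Rails k) = 1 := if_pos ⟨i, rfl⟩

lemma oneParticle_eq_diagonal (k : ℕ) : oneParticle k = Matrix.diagonal (hot (k := k)) := by
  ext x y
  simp only [oneParticle, Matrix.sum_apply, Matrix.single_apply, Matrix.diagonal_apply]
  by_cases hx : ∃ i, x = oneHot i
  · obtain ⟨i, rfl⟩ := hx
    rw [Finset.sum_eq_single i]
    · simp [hot_oneHot]
    · intro j _ hj
      simp [oneHot_injective.eq_iff, hj]
    · simp
  · push Not at hx
    rw [hot, if_neg (not_exists.mpr hx), ite_self]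
    exact Finset.sum_eq_zero fun i _ => if_neg fun h => hx i h.1.symm

lemma diagonal_kronecker_sandwich {A B : Type} [Fintype A] [DecidableEq A] [Fintype B]
    [DecidableEq B] (d : A → ℂ) (e : B → ℂ) (ρ : Op (A × B)) (p q : A × B) :
    ((Matrix.diagonal d ⊗ₖ Matrix.diagonal e) * ρ * (Matrix.diagonal d ⊗ₖ Matrix.diagonal e)) p q =
      d p.1 * e p.2 * ρ p q * (d q.1 * e q.2) := by
  rw [Matrix.diagonal_kronecker_diagonal, Matrix.mul_diagonal, Matrix.diagonal_mul]

/-- Post-selecting the damped rail state on the one-particle sector restores it. -/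
lemma oneParticle_sandwich {γ₁ γ₂ : ℝ} (h₁ : γ₁ ∈ Set.Icc (0 : ℝ) 1)
    (h₂ : γ₂ ∈ Set.Icc (0 : ℝ) 1) (k : ℕ) :
    (oneParticle k ⊗ₖ oneParticle k) * railOutput γ₁ γ₂ k * (oneParticle k ⊗ₖ oneParticle k) =
      (((1 - γ₁) * (1 - γ₂) : ℝ) : ℂ) • railState k := by
  ext ⟨x, y⟩ ⟨x', y'⟩
  rw [oneParticle_eq_diagonal, diagonal_kronecker_sandwich, Matrix.smul_apply, smul_eq_mul]
  have hz (z : Rails k) (w : Rails k) (h : ¬ ∃ i, z = oneHot i) : hot z = 0 ∧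
      railVec k (z, w) = 0 ∧ railVec k (w, z) = 0 := by
    refine ⟨if_neg h, railVec_eq_zero (fun i hi => h ⟨i, hi⟩) w, ?_⟩
    by_cases hw : ∃ i, w = oneHot i
    · obtain ⟨i, rfl⟩ := hw
      rw [railVec_oneHot, if_neg fun hi => h ⟨i, hi⟩]
    · exact railVec_eq_zero (fun i hi => hw ⟨i, hi⟩) z
  by_cases hx : ∃ i, x = oneHot i
  swap
  · simp [railState_apply, hz x y hx]
  by_cases hy : ∃ i, y = oneHot i
  swap
  · simp [railState_apply, hz y x hy]
  by_cases hx' : ∃ i, x' = oneHot i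
  swap
  · simp [railState_apply, hz x' y' hx']
  by_cases hy' : ∃ i, y' = oneHot i
  swap
  · simp [railState_apply, hz y' x' hy']
  obtain ⟨i, rfl⟩ := hx
  obtain ⟨i', rfl⟩ := hy
  obtain ⟨j, rfl⟩ := hx'
  obtain ⟨j', rfl⟩ := hy'
  simp only [hot_oneHot, railState_oneHot, railOutput_apply, tensorPow_ampDamp_oneHot h₁,
    tensorPow_ampDamp_oneHot h₂, one_mul, mul_one, oneHot_injective.eq_iff]
  -- Particles do not change rails, so only the term |e_i⟩⟨e_j| of ψ_k contributes to these entries.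
  rw [Finset.sum_eq_single i, Finset.sum_eq_single j]
  · by_cases e1 : i = i' <;> by_cases e2 : j = j' <;> simp [e1, e2, eq_comm]
    ring
  · intro b _ hb
    simp [hb]
  · simp
  · intro b _ hb
    simp [hb]
  · simp

lemma isMaxEntangled_railState (k : ℕ) : IsMaxEntangled k (railState k) := by
  have h (i j : Fin k) : dotProduct (star fun x : Rails k => if x = oneHot i then (1 : ℂ) else 0)
      (fun x => if x = oneHot j then 1 else 0) = if i = j then 1 else 0 := by
    simp only [dotProduct, Pi.star_apply, mul_ite, mul_one, mul_zero]
    rw [Finset.sum_ite_eq' Finset.univ]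
    simp [oneHot_injective.eq_iff, eq_comm]
  refine ⟨fun i x => if x = oneHot i then 1 else 0, fun i x => if x = oneHot i then 1 else 0,
    h, h, ?_⟩
  rw [railState]
  congr 1
  funext p
  rw [railVec]
  congr 1
  refine Finset.sum_congr rfl fun i _ => ?_
  by_cases h1 : p.1 = oneHot i <;> by_cases h2 : p.2 = oneHot i <;> simp [h1, h2, Prod.ext_iff]

/-! ### Post-selection of many blocks -/

/-- The indicator function of success (`true`) or failure (`false`) of the one-particle test. -/
def hotTest {k : ℕ} (u : Bool) (x : Rails k) : ℂ := if u then hot x else 1 - hot x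

lemma hot_eq_zero_or_one {k : ℕ} (x : Rails k) : hot x = 0 ∨ hot x = 1 := by
  rw [hot]
  split_ifs <;> simp

lemma hotTest_mul_self {k : ℕ} (u : Bool) (x : Rails k) :
    hotTest u x * hotTest u x = hotTest u x := by
  rcases hot_eq_zero_or_one x with h | h <;> cases u <;> simp [hotTest, h]

lemma star_hotTest {k : ℕ} (u : Bool) (x : Rails k) : star (hotTest u x) = hotTest u x := by
  rcases hot_eq_zero_or_one x with h | h <;> cases u <;> simp [hotTest, h]

lemma hotTest_nonneg {k : ℕ} (u : Bool) (x : Rails k) : 0 ≤ hotTest u x := by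
  rcases hot_eq_zero_or_one x with h | h <;> cases u <;> simp [hotTest, h]

/-- The diagonal of `sectorProj m k s`. -/
def sectorInd {m k : ℕ} (s : Finset (Fin m)) (x : Fin m → Rails k) : ℂ :=
  ∏ b, hotTest (decide (b ∈ s)) (x b)

lemma sectorProj_eq_diagonal {m k : ℕ} (s : Finset (Fin m)) :
    sectorProj m k s = Matrix.diagonal (sectorInd s) := by
  ext x y
  have h (u : Bool) : (if u then oneParticle k else 1 - oneParticle k) =
      Matrix.diagonal (hotTest (k := k) u) := by
    rw [oneParticle_eq_diagonal]
    cases u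
    · rw [← Matrix.diagonal_one, Matrix.diagonal_sub]
      rfl
    · rfl
  have h' : sectorProj m k s x y = ∏ b, (if decide (b ∈ s) then oneParticle k else
      1 - oneParticle k) (x b) (y b) := by
    simp only [sectorProj, Matrix.of_apply, decide_eq_true_eq]
  rw [h']
  simp only [h, Matrix.diagonal_apply, sectorInd, Finset.prod_ite_zero]
  simp [funext_iff]

/-- The probability that the two tests of a block have outcomes `u` and `v`. -/
def testProb (γ₁ γ₂ : ℝ) (k : ℕ) (u v : Bool) : ℂ :=
  ∑ x, ∑ y, hotTest u x * hotTest v y * railOutput γ₁ γ₂ k (x, y) (x, y)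

lemma testProb_nonneg {γ₁ γ₂ : ℝ} (h₁ : γ₁ ∈ Set.Icc (0 : ℝ) 1) (h₂ : γ₂ ∈ Set.Icc (0 : ℝ) 1)
    (k : ℕ) (u v : Bool) : 0 ≤ testProb γ₁ γ₂ k u v :=
  Finset.sum_nonneg fun _ _ => Finset.sum_nonneg fun _ _ =>
    mul_nonneg (mul_nonneg (hotTest_nonneg _ _) (hotTest_nonneg _ _))
      (railOutput_diag_nonneg h₁ h₂ _ _)

lemma testProb_true {γ₁ γ₂ : ℝ} (h₁ : γ₁ ∈ Set.Icc (0 : ℝ) 1) (h₂ : γ₂ ∈ Set.Icc (0 : ℝ) 1)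
    {k : ℕ} (hk : 1 ≤ k) : testProb γ₁ γ₂ k true true = (((1 - γ₁) * (1 - γ₂) : ℝ) : ℂ) := by
  have h := congrArg Matrix.trace (oneParticle_sandwich h₁ h₂ k)
  rw [Matrix.trace_smul, trace_railState hk, smul_eq_mul, mul_one] at h
  rw [← h, testProb]
  simp only [Matrix.trace, Matrix.diag, Fintype.sum_prod_type, oneParticle_eq_diagonal,
    diagonal_kronecker_sandwich]
  refine Finset.sum_congr rfl fun x _ => Finset.sum_congr rfl fun y _ => ?_
  have e1 := hotTest_mul_self true x
  have e2 := hotTest_mul_self true y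
  simp only [hotTest, if_true] at e1 e2 ⊢
  linear_combination (-railOutput γ₁ γ₂ k (x, y) (x, y)) * (hot y * hot y * e1 + hot x * e2)

lemma sum_testProb {γ₁ γ₂ : ℝ} (h₁ : γ₁ ∈ Set.Icc (0 : ℝ) 1) (h₂ : γ₂ ∈ Set.Icc (0 : ℝ) 1)
    {k : ℕ} (hk : 1 ≤ k) : testProb γ₁ γ₂ k true true + testProb γ₁ γ₂ k true false +
      (testProb γ₁ γ₂ k false true + testProb γ₁ γ₂ k false false) = 1 := by
  rw [← trace_railState hk, ← trace_tensorMap (tensorPow k (ampDamp γ₁)) (tensorPow k (ampDamp γ₂))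
    (trace_tensorPow k _ (trace_ampDamp h₁)) (trace_tensorPow k _ (trace_ampDamp h₂))]
  change _ = (railOutput γ₁ γ₂ k).trace
  simp only [Matrix.trace, Matrix.diag, Fintype.sum_prod_type, testProb, ← Finset.sum_add_distrib]
  refine Finset.sum_congr rfl fun x _ => Finset.sum_congr rfl fun y _ => ?_
  simp [hotTest]
  ring

/-- The probability that the successful blocks are `s` for the first and `t` for the second
receiver. -/
def sectorProb (γ₁ γ₂ : ℝ) (k : ℕ) {m : ℕ} (s t : Finset (Fin m)) : ℂ :=
  ∏ b, testProb γ₁ γ₂ k (decide (b ∈ s)) (decide (b ∈ t))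

lemma glue_mem {m : ℕ} {X : Type} (G : Finset (Fin m)) (x : {b // b ∈ G} → X)
    (r : {b // b ∉ G} → X) (b : {b // b ∈ G}) : glue G x r b = x b := by
  simp [glue]

lemma glue_not_mem {m : ℕ} {X : Type} (G : Finset (Fin m)) (x : {b // b ∈ G} → X)
    (r : {b // b ∉ G} → X) (b : {b // b ∉ G}) : glue G x r b = r b := by
  simp [glue, b.2]

/-- The sandwiched operator is a product over blocks. A block in s ∩ t contributes p ψ_k by
`oneParticle_sandwich`; any other block is traced out and contributes only the probability of its
two test outcomes. -/
lemma keepBlocks_sector {γ₁ γ₂ : ℝ} (h₁ : γ₁ ∈ Set.Icc (0 : ℝ) 1) (h₂ : γ₂ ∈ Set.Icc (0 : ℝ) 1)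
    {k m : ℕ} (hk : 1 ≤ k) (s t : Finset (Fin m)) :
    keepBlocks (s ∩ t) ((sectorProj m k s ⊗ₖ sectorProj m k t) *
      copies m (railOutput γ₁ γ₂ k) * (sectorProj m k s ⊗ₖ sectorProj m k t)) =
    sectorProb γ₁ γ₂ k s t • prodOp {b // b ∈ s ∩ t} (railState k) := by
  ext ⟨p, p'⟩ ⟨q, q'⟩
  set F : Fin m → Rails k → Rails k → Rails k → Rails k → ℂ := fun b x y x' y' =>
    hotTest (decide (b ∈ s)) x * hotTest (decide (b ∈ t)) y * railOutput γ₁ γ₂ k (x, y) (x', y') *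
      (hotTest (decide (b ∈ s)) x' * hotTest (decide (b ∈ t)) y') with hF
  have e1 (x x' y y' : Fin m → Rails k) : ((sectorProj m k s ⊗ₖ sectorProj m k t) *
      copies m (railOutput γ₁ γ₂ k) * (sectorProj m k s ⊗ₖ sectorProj m k t)) (x, y) (x', y') =
      ∏ b, F b (x b) (y b) (x' b) (y' b) := by
    rw [sectorProj_eq_diagonal, sectorProj_eq_diagonal, diagonal_kronecker_sandwich]
    simp only [hF, Finset.prod_mul_distrib]
    rfl
  have e2 (b : {b // b ∈ s ∩ t}) (x y x' y' : Rails k) : F b x y x' y' =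
      testProb γ₁ γ₂ k (decide (b.1 ∈ s)) (decide (b.1 ∈ t)) * railState k (x, y) (x', y') := by
    have hb := Finset.mem_inter.mp b.2
    have := congrFun (congrFun (oneParticle_sandwich h₁ h₂ k) (x, y)) (x', y')
    rw [oneParticle_eq_diagonal, diagonal_kronecker_sandwich] at this
    simpa [hF, hb.1, hb.2, testProb_true h₁ h₂ hk, hotTest] using this
  have e3 (b : {b // b ∉ s ∩ t}) : ∑ x, ∑ y, F b x y x y =
      testProb γ₁ γ₂ k (decide (b.1 ∈ s)) (decide (b.1 ∈ t)) := by
    rw [testProb]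
    refine Finset.sum_congr rfl fun x _ => Finset.sum_congr rfl fun y _ => ?_
    have e1 := hotTest_mul_self (decide (b.1 ∈ s)) x
    have e2 := hotTest_mul_self (decide (b.1 ∈ t)) y
    simp only [hF]
    linear_combination (railOutput γ₁ γ₂ k (x, y) (x, y)) *
      (hotTest (decide (b.1 ∈ t)) y * hotTest (decide (b.1 ∈ t)) y * e1 +
        hotTest (decide (b.1 ∈ s)) x * e2)
  rw [Matrix.smul_apply, smul_eq_mul]
  simp only [keepBlocks, Matrix.of_apply, e1, prodOp]
  simp only [← Fintype.prod_subtype_mul_prod_subtype (fun b => b ∈ s ∩ t), glue_mem, glue_not_mem,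
    e2, sectorProb, ← Finset.mul_sum, Finset.prod_mul_distrib]
  have e4 : ∑ r : {b // b ∉ s ∩ t} → Rails k, ∑ r' : {b // b ∉ s ∩ t} → Rails k,
      ∏ b : {b // b ∉ s ∩ t}, F b (r b) (r' b) (r b) (r' b) =
      ∏ b : {b // b ∉ s ∩ t}, testProb γ₁ γ₂ k (decide (b.1 ∈ s)) (decide (b.1 ∈ t)) := by
    simp only [← e3, Finset.prod_univ_sum, Fintype.piFinset_univ]
  rw [e4, mul_right_comm]
  congr!

lemma postSelect_copies {γ₁ γ₂ : ℝ} (h₁ : γ₁ ∈ Set.Icc (0 : ℝ) 1) (h₂ : γ₂ ∈ Set.Icc (0 : ℝ) 1)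
    {k m : ℕ} (hk : 1 ≤ k) {A' B' : Type} (K : ∀ G : Finset (Fin m),
      SuperOp (({b // b ∈ G} → Rails k) × ({b // b ∈ G} → Rails k)) (A' × B')) :
    postSelect K (copies m (railOutput γ₁ γ₂ k)) = ∑ s : Finset (Fin m), ∑ t : Finset (Fin m),
      sectorProb γ₁ γ₂ k s t • K (s ∩ t) (prodOp {b // b ∈ s ∩ t} (railState k)) := by
  simp only [postSelect, keepBlocks_sector h₁ h₂ hk, map_smul]

/-! ### Decoding the surviving blocks -/

/-- The basis string with one particle in each block, at the positions given by `s`. -/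
def railStr {ι : Type} {k : ℕ} (s : ι → Fin k) : ι → Rails k := fun b => oneHot (s b)

lemma railStr_injective {ι : Type} {k : ℕ} :
    Function.Injective (railStr : (ι → Fin k) → ι → Rails k) := fun _ _ h =>
  funext fun b => oneHot_injective (congrFun h b)

lemma prodOp_railStr {ι : Type} [Fintype ι] {k : ℕ} (s s' : ι → Fin k) (y y' : ι → Rails k) :
    prodOp ι (railState k) (railStr s, y) (railStr s', y') =
      if y = railStr s ∧ y' = railStr s' then ((k : ℂ)⁻¹) ^ Fintype.card ι else 0 := by
  have h (y : ι → Rails k) (s : ι → Fin k) : y = railStr s ↔ ∀ b, y b = oneHot (s b) := funext_iff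
  simp only [h, prodOp, Matrix.of_apply, railStr, railState_oneHot, Finset.prod_ite_zero,
    Finset.mem_univ, forall_const, forall_and, Finset.prod_const, Finset.card_univ]

lemma prodOp_eq_zero {ι : Type} [Fintype ι] {k : ℕ} {x : ι → Rails k}
    (hx : ∀ s, x ≠ railStr s) (y : ι → Rails k) (q : (ι → Rails k) × (ι → Rails k)) :
    prodOp ι (railState k) (x, y) q = 0 := by
  have : ∃ b, ∀ i, x b ≠ oneHot i := by
    by_contra! h
    choose s hs using h
    exact hx s (funext hs)
  obtain ⟨b, hb⟩ := this
  refine Finset.prod_eq_zero (Finset.mem_univ b) ?_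
  rw [railState_apply, railVec_eq_zero hb, zero_mul]

lemma trace_prodOp_railState (ι : Type) [Fintype ι] [DecidableEq ι] {k : ℕ} (hk : 1 ≤ k) :
    (prodOp ι (railState k)).trace = 1 := by
  rw [trace_prodOp, trace_railState hk, one_pow]

lemma copies_epr_apply (κ : ℕ) (p q : (Fin κ → Fin 2) × (Fin κ → Fin 2)) :
    copies κ epr p q = if p.2 = p.1 ∧ q.2 = q.1 then ((2 : ℂ)⁻¹) ^ κ else 0 := by
  have h2 : ((1 / √2 : ℝ) : ℂ) * star ((1 / √2 : ℝ) : ℂ) = (2 : ℂ)⁻¹ :=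
    inv_sqrt_mul_star 2
  have h (x y x' y' : Fin 2) : epr (x, y) (x', y') = if y = x ∧ y' = x' then (2 : ℂ)⁻¹ else 0 := by
    rw [← h2, epr]
    change (if x = y then ((1 / √2 : ℝ) : ℂ) else 0) *
      star (if x' = y' then ((1 / √2 : ℝ) : ℂ) else 0) = _
    by_cases h1 : x = y <;> by_cases h2 : x' = y' <;> simp [h1, h2, eq_comm]
  simp only [copies, Matrix.of_apply, h, Finset.prod_ite_zero]
  simp [funext_iff, forall_and]

lemma posSemidef_copies_epr (κ : ℕ) : (copies κ epr).PosSemidef := by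
  have h := (Matrix.posSemidef_vecMulVec_self_star
    (fun p : (Fin κ → Fin 2) × (Fin κ → Fin 2) => if p.2 = p.1 then (1 : ℂ) else 0)).smul
      (show (0 : ℝ) ≤ (2 : ℝ)⁻¹ ^ κ by positivity)
  convert h using 1
  ext p q
  rw [copies_epr_apply, Matrix.smul_apply, Matrix.vecMulVec_apply]
  by_cases h1 : p.2 = p.1 <;> by_cases h2 : q.2 = q.1 <;> simp [h1, h2]

lemma trace_copies_epr (κ : ℕ) : (copies κ epr).trace = 1 := by
  simp only [Matrix.trace, Matrix.diag, copies_epr_apply, and_self, Fintype.sum_prod_type,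
    Finset.sum_ite_eq', Finset.mem_univ, if_true]
  simp

/-- The channel that maps `|φ i⟩` to `|i⟩` and resets the orthogonal complement to `|0⟩`. -/
def decodeMap {κ : ℕ} {B : Type} [Fintype B] (φ : (Fin κ → Fin 2) → B) :
    SuperOp B (Fin κ → Fin 2) :=
  open scoped Classical in
  selectMap (R := Option B) (fun r i => r.elim (φ i) id)
    (fun r i => r.elim 1 fun x => if i = 0 ∧ ∀ j, φ j ≠ x then 1 else 0)

lemma isInstrument_decodeMap {κ : ℕ} {B : Type} [Fintype B] {φ : (Fin κ → Fin 2) → B}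
    (hφ : Function.Injective φ) : IsInstrument fun _ : Unit => decodeMap φ := by
  classical
  refine isInstrument_selectMap (Y := Unit) (C := fun _ => Fin κ → Fin 2) (R := fun _ => Option B)
    (fun _ r i => r.elim (φ i) id)
    (fun _ r i => r.elim 1 fun x => if i = 0 ∧ ∀ j, φ j ≠ x then 1 else 0) fun a => ?_
  simp only [Fintype.sum_option, Finset.univ_unique, Finset.sum_singleton, Option.elim_none,
    Option.elim_some, id_eq]
  by_cases ha : ∃ i, φ i = a
  · obtain ⟨i, rfl⟩ := ha
    rw [Finset.sum_eq_single i, Finset.sum_eq_zero]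
    · simp
    · intro x _
      refine Finset.sum_eq_zero fun j _ => ?_
      by_cases h1 : x = φ i
      · rw [if_neg (fun h => h.2 i h1.symm : ¬ (j = 0 ∧ ∀ j, φ j ≠ x)), zero_mul]
        exact if_pos h1
      · exact if_neg h1
    · intro j _ hj
      simp [hφ.eq_iff, hj]
    · simp
  · rw [Finset.sum_eq_zero, Finset.sum_eq_single a, Finset.sum_eq_single 0]
    · push Not at ha
      simp [ha]
    · intro j _ hj
      simp [hj]
    · simp
    · intro x _ hx
      simp [hx]
    · simp
    · intro i _
      exact if_neg fun h => ha ⟨i, h⟩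

/-- The reset branch reads only the diagonal entries ρ x x with x outside the range of φ, so these
alone must vanish. -/
lemma decodeMap_apply_of_support {κ : ℕ} {B : Type} [Fintype B] {φ : (Fin κ → Fin 2) → B}
    {ρ : Op B} (h : ∀ x, (∀ i, φ i ≠ x) → ρ x x = 0) (i j : Fin κ → Fin 2) :
    decodeMap φ ρ i j = ρ (φ i) (φ j) := by
  classical
  rw [decodeMap, selectMap_apply, Fintype.sum_option, Finset.sum_eq_zero]
  · simp
  · intro x _
    simp only [Option.elim_some, id_eq]
    by_cases hx : ∀ j, φ j ≠ x
    · simp [h x hx]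
    · simp [hx]

/-- Embed the 2^κ bit strings by e into the group (ℤ/k)^ι, which labels the one-particle strings.
The first receiver measures with K_j = 2^(-κ/2) ∑ᵢ |i⟩⟨e i + j|, one operator for each translation
j. Outcome j leaves ∑ᵢ |i⟩|e i + j⟩ up to normalization, and the second receiver, told j, decodes e
i + j to i. Translations cover the group evenly, so every outcome yields the EPR pairs exactly and
2^κ need not divide k^N. -/
lemma exists_locc_rail_to_epr {ι : Type} [Fintype ι] [DecidableEq ι] {k κ : ℕ} (hk : 1 ≤ k)
    (h : 2 ^ κ ≤ k ^ Fintype.card ι) :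
    ∃ K : SuperOp ((ι → Rails k) × (ι → Rails k)) ((Fin κ → Fin 2) × (Fin κ → Fin 2)),
      IsLOCC _ _ _ _ K ∧ K (prodOp ι (railState k)) = copies κ epr := by
  classical
  have : NeZero k := ⟨by omega⟩
  obtain ⟨e⟩ : Nonempty ((Fin κ → Fin 2) ↪ (ι → Fin k)) :=
    Function.Embedding.nonempty_of_card_le (by simpa using h)
  have hφ (j : ι → Fin k) : Function.Injective fun i => (railStr (e i + j) : ι → Rails k) :=
    fun i i' hi => e.injective (add_right_cancel (railStr_injective hi))
  let f : ∀ y : (ι → Fin k) ⊕ (ι → Rails k), Unit → (Fin κ → Fin 2) → (ι → Rails k) := fun y _ i =>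
    Sum.elim (fun j => railStr (e i + j)) id y
  let d : ∀ y : (ι → Fin k) ⊕ (ι → Rails k), Unit → (Fin κ → Fin 2) → ℂ := fun y _ i =>
    Sum.elim (fun _ => ((1 / √(2 ^ κ : ℕ) : ℝ) : ℂ))
      (fun x => if i = 0 ∧ ∀ s, railStr s ≠ x then 1 else 0) y
  -- The outcomes `Sum.inr x` complete the instrument off the one-particle strings and have
  -- probability zero here. The shift 0 after them is a dummy value.
  let φ : (ι → Fin k) ⊕ (ι → Rails k) → (Fin κ → Fin 2) → (ι → Rails k) := fun y i =>
    railStr (e i + y.elim id 0)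
  have hM : IsInstrument fun y => selectMap (f y) (d y) := by
    refine isInstrument_selectMap f d fun a => ?_
    have hl (j : ι → Fin k) : (∑ r, ∑ i, if f (Sum.inl j) r i = a then
        d (Sum.inl j) r i * star (d (Sum.inl j) r i) else 0) =
        ∑ i, if (railStr (e i + j) : ι → Rails k) = a then (((2 ^ κ : ℕ) : ℂ))⁻¹ else 0 := by
      rw [Finset.univ_unique, Finset.sum_singleton]
      refine Finset.sum_congr rfl fun i _ => ?_
      rw [← inv_sqrt_mul_star]
      rfl
    have hr (x : ι → Rails k) : (∑ r, ∑ i, if f (Sum.inr x) r i = a then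
        d (Sum.inr x) r i * star (d (Sum.inr x) r i) else 0) =
        if x = a then (if ∀ s, railStr s ≠ x then (1 : ℂ) else 0) else 0 := by
      rw [Finset.univ_unique, Finset.sum_singleton, Finset.sum_eq_single 0]
      · by_cases hx : x = a <;> by_cases hs : ∀ s, railStr s ≠ x <;>
          simp [f, d, hx]
      · intro i _ hi
        simp [d, hi]
      · simp
    rw [Fintype.sum_sum_type]
    simp only [hl, hr, Finset.sum_ite_eq', Finset.mem_univ, if_true]
    by_cases ha : ∃ s, railStr s = a
    · obtain ⟨s, rfl⟩ := ha
      rw [if_neg fun h => h s rfl, Finset.sum_comm, add_zero]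
      have h2 (i : Fin κ → Fin 2) : ∑ j : ι → Fin k, (if (railStr (e i + j) : ι → Rails k) =
          railStr s then (((2 ^ κ : ℕ) : ℂ))⁻¹ else 0) = (((2 ^ κ : ℕ) : ℂ))⁻¹ := by
        -- For each i exactly one translation carries e i to s. The 2^κ values of i, each of weight
        -- 2^(-κ), then add up to 1.
        rw [Finset.sum_eq_single (s - e i)]
        · simp
        · intro j _ hj
          refine if_neg fun h => hj ?_
          rw [← railStr_injective h, add_sub_cancel_left]
        · simp
      simp only [h2]
      simp
    · rw [if_pos (not_exists.mp ha), Finset.sum_eq_zero, zero_add]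
      exact fun j _ => Finset.sum_eq_zero fun i _ => if_neg fun h => ha ⟨_, h⟩
  refine ⟨_, IsLOCC.left (fun y => selectMap (f y) (d y))
    (fun y => ∑ _ : Unit, LinearMap.id.comp (onRight _ (decodeMap (φ y)))) hM fun y =>
      IsLOCC.right (fun _ : Unit => decodeMap (φ y)) (fun _ => LinearMap.id)
        (isInstrument_decodeMap (hφ _)) fun _ => IsLOCC.done _ _, ?_⟩
  simp only [Finset.univ_unique, Finset.sum_singleton, LinearMap.id_comp]
  ext ⟨i, a⟩ ⟨i', a'⟩
  rw [LinearMap.sum_apply, Matrix.sum_apply, Fintype.sum_sum_type]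
  simp only [LinearMap.comp_apply]
  have key (j : ι → Fin k) (i i' : Fin κ → Fin 2) (b b' : ι → Rails k) :
      onLeft (ι → Rails k) (selectMap (f (Sum.inl j)) (d (Sum.inl j))) (prodOp ι (railState k))
        (i, b) (i', b') = if b = railStr (e i + j) ∧ b' = railStr (e i' + j) then
          (((2 ^ κ : ℕ) : ℂ))⁻¹ * ((k : ℂ)⁻¹) ^ Fintype.card ι else 0 := by
    rw [onLeft_apply, selectMap_apply]
    simp only [Finset.univ_unique, Finset.sum_singleton, f, d, Sum.elim_inl, Matrix.of_apply,
      prodOp_railStr]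
    rw [mul_right_comm, inv_sqrt_mul_star, mul_ite, mul_zero]
  have keyr (x : ι → Rails k) :
      onLeft (ι → Rails k) (selectMap (f (Sum.inr x)) (d (Sum.inr x))) (prodOp ι (railState k)) =
        0 := by
    ext ⟨i, b⟩ ⟨i', b'⟩
    rw [onLeft_apply, selectMap_apply]
    simp only [Finset.univ_unique, Finset.sum_singleton, f, d, Sum.elim_inr, Matrix.of_apply, id_eq]
    by_cases hx : ∀ s, railStr s ≠ x
    · rw [prodOp_eq_zero fun s hs => hx s hs.symm]
      simp
    · simp [hx]
  simp only [keyr, map_zero, Matrix.zero_apply, Finset.sum_const_zero, add_zero]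
  have hterm (j : ι → Fin k) : onRight (Fin κ → Fin 2) (decodeMap (φ (Sum.inl j)))
      (onLeft (ι → Rails k) (selectMap (f (Sum.inl j)) (d (Sum.inl j))) (prodOp ι (railState k)))
      (i, a) (i', a') = if a = i ∧ a' = i' then
        (((2 ^ κ : ℕ) : ℂ))⁻¹ * ((k : ℂ)⁻¹) ^ Fintype.card ι else 0 := by
    rw [onRight_apply, decodeMap_apply_of_support]
    · simp only [Matrix.of_apply, key, φ, Sum.elim_inl, id_eq, (hφ j).eq_iff]
    · intro x hx
      simp only [Matrix.of_apply, key]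
      exact if_neg fun h => hx i h.1.symm
  have hk' : (k : ℂ) ≠ 0 := by exact_mod_cast (by omega : k ≠ 0)
  -- All k^N translations give the same contribution, of weight 2^(-κ) k^(-N), where N is the
  -- cardinality of ι.
  simp only [hterm, copies_epr_apply, Finset.sum_const, Finset.card_univ, Fintype.card_fun,
    Fintype.card_fin, nsmul_eq_mul, mul_ite, mul_zero]
  congr 1
  push_cast
  rw [inv_pow, inv_pow]
  field_simp

/-- The channel that discards its input and prepares `|c⟩⟨c|`. -/
def resetMap (A : Type) [Fintype A] {C : Type} [DecidableEq C] (c : C) : SuperOp A C :=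
  selectMap (R := A) (fun x _ => x) fun _ i => if i = c then 1 else 0

lemma resetMap_apply {A : Type} [Fintype A] {C : Type} [DecidableEq C] (c : C) (ρ : Op A)
    (i j : C) : resetMap A c ρ i j = if i = c ∧ j = c then ρ.trace else 0 := by
  rw [resetMap, selectMap_apply]
  by_cases h1 : i = c <;> by_cases h2 : j = c <;> simp [h1, h2, Matrix.trace]

lemma isInstrument_resetMap (A : Type) [Fintype A] {C : Type} [Fintype C] [DecidableEq C] (c : C) :
    IsInstrument fun _ : Unit => resetMap A c := by
  classical
  refine isInstrument_selectMap (Y := Unit) (C := fun _ => C) (R := fun _ => A)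
    (fun _ x _ => x) (fun _ _ i => if i = c then 1 else 0) fun a => ?_
  rw [Finset.univ_unique, Finset.sum_singleton, Finset.sum_eq_single a]
  · simp
  · intro x _ hx
    simp [hx]
  · simp

/-- The fallback when too few blocks survive: prepare a fixed product state. -/
lemma exists_locc_reset (A B : Type) [Fintype A] [Fintype B] {C D : Type} [Fintype C] [DecidableEq C]
    [Fintype D] [DecidableEq D] (c : C) (d : D) :
    ∃ K : SuperOp (A × B) (C × D), IsLOCC _ _ _ _ K ∧
      ∀ ρ, K ρ = ρ.trace • Matrix.single (c, d) (c, d) 1 := by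
  refine ⟨_, IsLOCC.left (fun _ : Unit => resetMap A c)
    (fun _ => ∑ _ : Unit, LinearMap.id.comp (onRight _ (resetMap B d)))
    (isInstrument_resetMap A c) fun _ =>
      IsLOCC.right (fun _ : Unit => resetMap B d) (fun _ => LinearMap.id)
        (isInstrument_resetMap B d) fun _ => IsLOCC.done _ _, fun ρ => ?_⟩
  ext ⟨i, a⟩ ⟨i', a'⟩
  simp only [LinearMap.comp_apply, LinearMap.id_apply,
    Finset.univ_unique, Finset.sum_singleton, onRight_apply, onLeft_apply, resetMap_apply,
    Matrix.trace, Matrix.diag, Matrix.of_apply, Matrix.smul_apply, Matrix.single_apply,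
    Fintype.sum_prod_type_right, smul_eq_mul, mul_ite, mul_one, mul_zero, Prod.mk.injEq,
    @eq_comm _ c, @eq_comm _ d]
  by_cases h1 : i = c <;> by_cases h2 : i' = c <;> by_cases h3 : a = d <;> by_cases h4 : a' = d <;>
    simp [h1, h2, h3, h4]

/-! ### The error of the multi-rail protocol -/

lemma sum_finset_prod_decide {R : Type} [CommSemiring R] {m : ℕ} (g : Fin m → Bool → R) :
    ∑ s : Finset (Fin m), ∏ b, g b (decide (b ∈ s)) = ∏ b, (g b true + g b false) := by
  rw [Finset.prod_add, Finset.powerset_univ]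
  refine Finset.sum_congr rfl fun s _ => ?_
  rw [← Finset.prod_sdiff (Finset.subset_univ s), mul_comm]
  congr 1
  · exact Finset.prod_congr rfl fun b hb => by simp [hb]
  · exact Finset.prod_congr rfl fun b hb => by simp [(Finset.mem_sdiff.mp hb).2]

/-- Blocks are independent, so summing over pairs of subsets gives an m-th power. Used both for the
total probability and for the exponential moment. -/
lemma sum_finset_sum_finset_prod_decide {R : Type} [CommSemiring R] (m : ℕ) (f : Bool → Bool → R) :
    ∑ s : Finset (Fin m), ∑ t : Finset (Fin m), ∏ b, f (decide (b ∈ s)) (decide (b ∈ t)) =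
      (f true true + f true false + (f false true + f false false)) ^ m := by
  have h (s : Finset (Fin m)) := sum_finset_prod_decide fun b v => f (decide (b ∈ s)) v
  simp only [h]
  rw [sum_finset_prod_decide fun b u => f u true + f u false]
  simp

/-- The probability that the successful blocks are `s` and `t`, as a real number. -/
def sectorProbRe (γ₁ γ₂ : ℝ) (k : ℕ) {m : ℕ} (s t : Finset (Fin m)) : ℝ :=
  ∏ b, (testProb γ₁ γ₂ k (decide (b ∈ s)) (decide (b ∈ t))).re

section
variable {γ₁ γ₂ : ℝ} (h₁ : γ₁ ∈ Set.Icc (0 : ℝ) 1) (h₂ : γ₂ ∈ Set.Icc (0 : ℝ) 1)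
include h₁ h₂

lemma testProb_re_nonneg (k : ℕ) (u v : Bool) : 0 ≤ (testProb γ₁ γ₂ k u v).re :=
  (Complex.nonneg_iff.mp (testProb_nonneg h₁ h₂ k u v)).1

lemma sectorProbRe_nonneg (k : ℕ) {m : ℕ} (s t : Finset (Fin m)) :
    0 ≤ sectorProbRe γ₁ γ₂ k s t :=
  Finset.prod_nonneg fun _ _ => testProb_re_nonneg h₁ h₂ k _ _

lemma sectorProb_eq_ofReal (k : ℕ) {m : ℕ} (s t : Finset (Fin m)) :
    sectorProb γ₁ γ₂ k s t = (sectorProbRe γ₁ γ₂ k s t : ℂ) := by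
  rw [sectorProb, sectorProbRe, Complex.ofReal_prod]
  refine Finset.prod_congr rfl fun b _ => ?_
  refine Complex.ext rfl ?_
  rw [Complex.ofReal_im]
  exact (Complex.nonneg_iff.mp (testProb_nonneg h₁ h₂ k _ _)).2.symm

lemma sum_testProb_re {k : ℕ} (hk : 1 ≤ k) :
    (testProb γ₁ γ₂ k true true).re + (testProb γ₁ γ₂ k true false).re +
      ((testProb γ₁ γ₂ k false true).re + (testProb γ₁ γ₂ k false false).re) = 1 := by
  simpa using congrArg Complex.re (sum_testProb h₁ h₂ hk)

lemma sum_sectorProbRe {k : ℕ} (hk : 1 ≤ k) (m : ℕ) :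
    ∑ s : Finset (Fin m), ∑ t : Finset (Fin m), sectorProbRe γ₁ γ₂ k s t = 1 := by
  have := sum_finset_sum_finset_prod_decide m fun u v => (testProb γ₁ γ₂ k u v).re
  rw [sum_testProb_re h₁ h₂ hk, one_pow] at this
  exact this

/-- The protocol fails only if too few blocks survive the tests. -/
lemma hasRailCode_of_prob {k : ℕ} (hk : 1 ≤ k) (m κ : ℕ) :
    HasRailCode γ₁ γ₂ k m κ (2 * ∑ s : Finset (Fin m), ∑ t : Finset (Fin m),
      if 2 ^ κ ≤ k ^ (s ∩ t).card then 0 else sectorProbRe γ₁ γ₂ k s t) := by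
  -- The two receivers' strings differ when κ > 0, so this failure state is orthogonal to the EPR
  -- pairs and the trace norm can be computed exactly as twice the failure probability.
  set σ : Op ((Fin κ → Fin 2) × (Fin κ → Fin 2)) :=
    Matrix.single (fun _ => 0, fun _ => 1) (fun _ => 0, fun _ => 1) 1 with hσ
  have hK (G : Finset (Fin m)) : ∃ K : SuperOp (({b // b ∈ G} → Rails k) × ({b // b ∈ G} → Rails k))
      ((Fin κ → Fin 2) × (Fin κ → Fin 2)), IsLOCC _ _ _ _ K ∧
      K (prodOp {b // b ∈ G} (railState k)) =
        if 2 ^ κ ≤ k ^ G.card then copies κ epr else σ := by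
    split_ifs with h
    · exact exists_locc_rail_to_epr hk (by simpa using h)
    · obtain ⟨K, hK, hK'⟩ := exists_locc_reset ({b // b ∈ G} → Rails k) ({b // b ∈ G} → Rails k)
        (fun _ : Fin κ => (0 : Fin 2)) (fun _ : Fin κ => (1 : Fin 2))
      exact ⟨K, hK, by rw [hK', trace_prodOp_railState _ hk, one_smul]⟩
  choose K hK hK' using hK
  refine ⟨K, hK, ?_⟩
  rw [tensorMap_tensorPow_copies]
  change traceNorm (_ - postSelect K (copies m (railOutput γ₁ γ₂ k))) ≤ _
  rw [postSelect_copies h₁ h₂ hk]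
  simp only [hK', sectorProb_eq_ofReal h₁ h₂]
  set q : ℝ := ∑ s : Finset (Fin m), ∑ t : Finset (Fin m),
    if 2 ^ κ ≤ k ^ (s ∩ t).card then 0 else sectorProbRe γ₁ γ₂ k s t with hq
  have hq0 : 0 ≤ q := Finset.sum_nonneg fun s _ => Finset.sum_nonneg fun t _ => by
    split_ifs
    · rfl
    · exact sectorProbRe_nonneg h₁ h₂ k s t
  have hσ' : σ.PosSemidef := by
    have : σ = Matrix.diagonal (Pi.single (fun _ => 0, fun _ => 1) 1) := by
      rw [hσ, Matrix.diagonal_single]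
    rw [this]
    refine Matrix.PosSemidef.diagonal fun i => ?_
    rw [Pi.single_apply]
    split_ifs <;> simp
  have hdiff : copies κ epr - (∑ s : Finset (Fin m), ∑ t : Finset (Fin m),
      (sectorProbRe γ₁ γ₂ k s t : ℂ) • if 2 ^ κ ≤ k ^ (s ∩ t).card then copies κ epr else σ) =
      q • copies κ epr - q • σ := by
    have h1 : copies κ epr = ∑ s : Finset (Fin m), ∑ t : Finset (Fin m),
        sectorProbRe γ₁ γ₂ k s t • copies κ epr := by
      simp only [← Finset.sum_smul]
      rw [sum_sectorProbRe h₁ h₂ hk, one_smul]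
    rw [← smul_sub, hq]
    refine (congrArg (· - _) h1).trans ?_
    rw [Finset.sum_smul, ← Finset.sum_sub_distrib]
    refine Finset.sum_congr rfl fun s _ => ?_
    rw [Finset.sum_smul, ← Finset.sum_sub_distrib]
    refine Finset.sum_congr rfl fun t _ => ?_
    have h2 : ∀ Z : Op ((Fin κ → Fin 2) × (Fin κ → Fin 2)),
        (sectorProbRe γ₁ γ₂ k s t : ℂ) • Z = sectorProbRe γ₁ γ₂ k s t • Z := fun Z => by
      ext
      simp
    rw [h2]
    split_ifs
    · simp
    · rw [smul_sub]
  rw [hdiff]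
  -- For κ = 0 there is no orthogonality, but then failure is impossible and q = 0.
  have hmul : (q • copies κ epr) * (q • σ) = 0 := by
    rcases Nat.eq_zero_or_pos κ with rfl | hκ
    · have : q = 0 := by
        rw [hq]
        refine Finset.sum_eq_zero fun s _ => Finset.sum_eq_zero fun t _ => if_pos ?_
        rw [pow_zero]
        exact Nat.one_le_pow _ _ hk
      rw [this, zero_smul, zero_mul]
    · have : copies κ epr * σ = 0 := by
        ext p r
        rw [Matrix.mul_apply, Matrix.zero_apply]
        refine Finset.sum_eq_zero fun z _ => ?_
        rw [copies_epr_apply, hσ, Matrix.single_apply]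
        by_cases hz : z = (fun _ => 0, fun _ => 1)
        · rw [if_neg, zero_mul]
          rintro ⟨-, h⟩
          rw [hz] at h
          exact one_ne_zero (congrFun h ⟨0, hκ⟩)
        · exact mul_eq_zero_of_right _ (if_neg fun h => hz h.1.symm)
      rw [Matrix.smul_mul, Matrix.mul_smul, this, smul_zero, smul_zero]
  rw [traceNorm_sub_of_mul_eq_zero ((posSemidef_copies_epr κ).smul hq0) (hσ'.smul hq0) hmul,
    Matrix.trace_smul, Matrix.trace_smul, trace_copies_epr, hσ, Matrix.trace_single_eq_same]
  simp
  linarith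

/-- The Chernoff bound for the number of surviving blocks. -/
lemma sum_sectorProbRe_le {k : ℕ} (hk : 1 ≤ k) (m κ : ℕ) {g l : ℝ} (hl : 0 ≤ l) (hl1 : l ≤ 1)
    (hg : ∀ N : ℕ, ¬ 2 ^ κ ≤ k ^ N → (N : ℝ) ≤ g) :
    (∑ s : Finset (Fin m), ∑ t : Finset (Fin m),
      if 2 ^ κ ≤ k ^ (s ∩ t).card then 0 else sectorProbRe γ₁ γ₂ k s t) ≤
      Real.exp (l * g - m * ((1 - γ₁) * (1 - γ₂)) * (l - l ^ 2)) := by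
  set p : ℝ := (1 - γ₁) * (1 - γ₂) with hp
  have hp0 : 0 ≤ p := mul_nonneg (by linarith [h₁.2]) (by linarith [h₂.2])
  -- Single-block probabilities tilted by e^(-l) on a survivor; their product over blocks weighs (s,
  -- t) by e^(-l |s ∩ t|).
  set f : Bool → Bool → ℝ := fun u v => (testProb γ₁ γ₂ k u v).re *
    if u && v then Real.exp (-l) else 1 with hf
  have hpt : (testProb γ₁ γ₂ k true true).re = p := by
    rw [testProb_true h₁ h₂ hk, Complex.ofReal_re]
  have hfs : f true true + f true false + (f false true + f false false) =
      1 - p * (1 - Real.exp (-l)) := by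
    have := sum_testProb_re h₁ h₂ hk
    rw [hpt] at this
    simp only [hf, hpt, Bool.and_true, Bool.and_false, Bool.false_eq_true, if_true, if_false]
    linarith
  have hprod (s t : Finset (Fin m)) : ∏ b, f (decide (b ∈ s)) (decide (b ∈ t)) =
      sectorProbRe γ₁ γ₂ k s t * Real.exp (-l * (s ∩ t).card) := by
    simp only [hf, Finset.prod_mul_distrib, sectorProbRe]
    congr 1
    have : ∀ b, (decide (b ∈ s) && decide (b ∈ t)) = decide (b ∈ s ∩ t) := fun b => by
      simp [Finset.mem_inter]
    simp only [this, decide_eq_true_eq]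
    rw [Finset.prod_ite_mem, Finset.univ_inter, Finset.prod_const, ← Real.exp_nat_mul]
    ring_nf
  -- Markov's inequality: on failure |s ∩ t| ≤ g, so the indicator is at most e^(l g) e^(-l |s ∩
  -- t|).
  calc _ ≤ ∑ s : Finset (Fin m), ∑ t : Finset (Fin m),
        Real.exp (l * g) * ∏ b, f (decide (b ∈ s)) (decide (b ∈ t)) := by
        refine Finset.sum_le_sum fun s _ => Finset.sum_le_sum fun t _ => ?_
        have hc := sectorProbRe_nonneg h₁ h₂ k s t
        rw [hprod]
        split_ifs with h
        · positivity
        · rw [mul_left_comm, ← Real.exp_add]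
          refine le_mul_of_one_le_right hc (Real.one_le_exp ?_)
          nlinarith [hg _ h]
    _ = Real.exp (l * g) * (1 - p * (1 - Real.exp (-l))) ^ m := by
        simp only [← Finset.mul_sum]
        rw [sum_finset_sum_finset_prod_decide m f, hfs]
    _ ≤ Real.exp (l * g) * Real.exp (-(p * (l - l ^ 2))) ^ m := by
        have he : Real.exp (-l) ≤ 1 - l + l ^ 2 := by
          have := (abs_le.mp (Real.abs_exp_sub_one_sub_id_le (x := -l)
            (by rw [abs_neg, abs_of_nonneg hl]; exact hl1))).2
          linarith [neg_sq l]
        have hbase : 0 ≤ 1 - p * (1 - Real.exp (-l)) := by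
          rw [← hfs]
          have hf0 (u v : Bool) : 0 ≤ f u v := mul_nonneg (testProb_re_nonneg h₁ h₂ k u v) (by
            split_ifs <;> positivity)
          linarith [hf0 true true, hf0 true false, hf0 false true, hf0 false false]
        gcongr
        have h3 : p * (l - l ^ 2) ≤ p * (1 - Real.exp (-l)) :=
          mul_le_mul_of_nonneg_left (by linarith) hp0
        linarith [Real.add_one_le_exp (-(p * (l - l ^ 2)))]
    _ = _ := by
        rw [← Real.exp_nat_mul, ← Real.exp_add]
        congr 1
        ring
end

/-! ### Choice of the yield and of the Chernoff parameter -/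

lemma HasRailCode.mono {γ₁ γ₂ : ℝ} {k m κ : ℕ} {ε ε' : ℝ} (h : HasRailCode γ₁ γ₂ k m κ ε)
    (hε : ε ≤ ε') : HasRailCode γ₁ γ₂ k m κ ε' := by
  obtain ⟨K, hK, hK'⟩ := h
  exact ⟨K, hK, hK'.trans hε⟩

/-- The number of EPR pairs extracted from `m` blocks of `k` rails if a block survives with
probability `p`. -/
def railYield (p : ℝ) (k m : ℕ) : ℕ :=
  ⌊Real.logb 2 k * (m * p - (m : ℝ) ^ (2 / 3 : ℝ))⌋₊

/-- The slack m^(2/3) lies between the fluctuations √m and the mean of order m, so the error tends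
to 0 while the rate is unaffected. -/
lemma hasRailCode_railYield {γ₁ γ₂ : ℝ} (h₁ : γ₁ ∈ Set.Icc (0 : ℝ) 1)
    (h₂ : γ₂ ∈ Set.Icc (0 : ℝ) 1) {k : ℕ} (hk : 1 ≤ k) (m : ℕ) :
    HasRailCode γ₁ γ₂ k m (railYield ((1 - γ₁) * (1 - γ₂)) k m)
      (2 * Real.exp (-((m : ℝ) ^ (1 / 3 : ℝ) / 4))) := by
  set p : ℝ := (1 - γ₁) * (1 - γ₂) with hp
  have hp0 : 0 ≤ p := mul_nonneg (by linarith [h₁.2]) (by linarith [h₂.2])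
  have hp1 : p ≤ 1 := mul_le_one₀ (by linarith [h₁.1]) (by linarith [h₂.2]) (by linarith [h₂.1])
  refine (hasRailCode_of_prob h₁ h₂ hk m (railYield p k m)).mono ?_
  refine mul_le_mul_of_nonneg_left ?_ two_pos.le
  have hk0 : (0 : ℝ) < k := by exact_mod_cast hk
  have hlog : 0 ≤ Real.logb 2 k := Real.logb_nonneg one_lt_two (by exact_mod_cast hk)
  have hg (N : ℕ) (hN : ¬ 2 ^ railYield p k m ≤ k ^ N) :
      (N : ℝ) ≤ m * p - (m : ℝ) ^ (2 / 3 : ℝ) := by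
    -- Zero pairs can always be produced, so a failure means the floor was not truncated at 0 and
    -- its argument is nonnegative.
    have h0 : railYield p k m ≠ 0 := fun h => hN (by rw [h, pow_zero]; exact Nat.one_le_pow _ _ hk)
    have hle : (railYield p k m : ℝ) ≤ Real.logb 2 k * (m * p - (m : ℝ) ^ (2 / 3 : ℝ)) :=
      Nat.floor_le (zero_le_one.trans (Nat.floor_pos.mp (Nat.pos_of_ne_zero h0)))
    have hlt : (k : ℝ) ^ N < (2 : ℝ) ^ railYield p k m := by exact_mod_cast not_le.mp hN
    have h3 := Real.logb_lt_logb one_lt_two (pow_pos hk0 N) hlt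
    rw [Real.logb_pow, Real.logb_pow, Real.logb_self_eq_one one_lt_two, mul_one] at h3
    have h4 := h3.trans_le hle
    rw [mul_comm] at h4
    exact (lt_of_mul_lt_mul_left h4 hlog).le
  rcases Nat.eq_zero_or_pos m with rfl | hm
  · have h0 : railYield p k 0 = 0 := by simp [railYield]
    rw [h0]
    refine (Finset.sum_nonpos fun s _ => Finset.sum_nonpos fun t _ => ?_).trans (Real.exp_nonneg _)
    rw [pow_zero, if_pos (Nat.one_le_pow _ _ hk)]
  have hm1 : (1 : ℝ) ≤ m := by exact_mod_cast hm
  have hm0 : (0 : ℝ) < m := by linarith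
  set c : ℝ := (m : ℝ) ^ (1 / 3 : ℝ) with hc
  have hc1 : 1 ≤ c := Real.one_le_rpow hm1 (by norm_num)
  have hc0 : 0 < c := by linarith
  have hc3 : (m : ℝ) = c ^ 3 := by
    rw [hc, ← Real.rpow_natCast, ← Real.rpow_mul hm0.le]
    norm_num
  have hc2 : (m : ℝ) ^ (2 / 3 : ℝ) = c ^ 2 := by
    rw [hc, ← Real.rpow_natCast, ← Real.rpow_mul hm0.le]
    norm_num
  -- With m = c³ the exponent is -l c² + p c³ l², the mean having cancelled. At l = 1/(2c) it equals
  -- -c/2 + pc/4, and p ≤ 1 makes it at most -c/4.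
  refine (sum_sectorProbRe_le h₁ h₂ hk m _ (l := 1 / (2 * c)) (by positivity) ?_ hg).trans ?_
  · rw [div_le_one (by positivity)]
    linarith
  · refine Real.exp_le_exp.mpr ?_
    rw [← hp, hc2, hc3]
    have : 1 / (2 * c) * (c ^ 3 * p - c ^ 2) - c ^ 3 * p * (1 / (2 * c) - (1 / (2 * c)) ^ 2) =
        - (c / 2) + p * c / 4 := by
      field_simp
      ring
    rw [this]
    nlinarith

/-! ### From rail codes to EPR codes -/

/-- The qubit string consisting of the blocks `p` and the unused qubits `r`. -/
def assemble {n m k r : ℕ} (e : Fin n ≃ (Fin m × Fin k) ⊕ Fin r) (p : Fin m → Rails k)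
    (z : Fin r → Fin 2) : Fin n → Fin 2 :=
  fun t => Sum.elim (fun b => p b.1 b.2) z (e t)

lemma assemble_eq_iff {n m k r : ℕ} (e : Fin n ≃ (Fin m × Fin k) ⊕ Fin r) (p : Fin m → Rails k)
    (z : Fin r → Fin 2) (x : Fin n → Fin 2) : assemble e p z = x ↔
      p = (fun b t => x (e.symm (Sum.inl (b, t)))) ∧ z = fun u => x (e.symm (Sum.inr u)) := by
  constructor
  · rintro rfl
    exact ⟨by funext b t; simp [assemble], by funext u; simp [assemble]⟩
  · rintro ⟨rfl, rfl⟩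
    funext t
    obtain ⟨b | u, rfl⟩ := e.symm.surjective t <;> simp [assemble]

lemma glue_eq_iff {m : ℕ} {X : Type} (G : Finset (Fin m)) (x : {b // b ∈ G} → X)
    (r : {b // b ∉ G} → X) (y : Fin m → X) :
    glue G x r = y ↔ x = (fun b => y b.1) ∧ r = fun b => y b.1 := by
  constructor
  · rintro rfl
    exact ⟨by funext b; rw [glue_mem], by funext b; rw [glue_not_mem]⟩
  · rintro ⟨rfl, rfl⟩
    funext b
    by_cases h : b ∈ G <;> simp [glue, h]

lemma sum_sum_ite_of_iff {R X : Type} [Fintype R] [Fintype X] {P : R → X → Prop}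
    [∀ r x, Decidable (P r x)] (r₀ : R) (x₀ : X) (h : ∀ r x, P r x ↔ x = x₀ ∧ r = r₀)
    (F : R → X → ℂ) : ∑ r, ∑ x, (if P r x then F r x else 0) = F r₀ x₀ := by
  rw [Finset.sum_eq_single r₀, Finset.sum_eq_single x₀]
  · exact if_pos ((h _ _).mpr ⟨rfl, rfl⟩)
  · exact fun x _ hx => if_neg fun h' => hx ((h _ _).mp h').1
  · simp
  · exact fun r _ hr => Finset.sum_eq_zero fun x _ => if_neg fun h' => hr ((h _ _).mp h').2
  · simp

section
variable {n m k r : ℕ} (e : Fin n ≃ (Fin m × Fin k) ⊕ Fin r)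

/-- Trace out the unused qubits. -/
def traceRest : SuperOp (Fin n → Fin 2) (Fin m → Rails k) :=
  selectMap (R := Fin r → Fin 2) (fun z p => assemble e p z) fun _ _ => 1

/-- Append unused qubits in the state `|0⟩`. -/
def padZero : SuperOp (Fin m → Rails k) (Fin n → Fin 2) :=
  selectMap (R := Unit) (fun _ x b t => x (e.symm (Sum.inl (b, t))))
    fun _ x => if (0 : Fin r → Fin 2) = (fun u => x (e.symm (Sum.inr u))) then 1 else 0

/-- Trace out the unused qubits and perform the one-particle test, with outcome `s`. -/
def testMap (s : Finset (Fin m)) : SuperOp (Fin n → Fin 2) (Fin m → Rails k) :=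
  selectMap (R := Fin r → Fin 2) (fun z p => assemble e p z) fun _ p => sectorInd s p

lemma padZero_single (p q : Fin m → Rails k) : padZero e (Matrix.single p q 1) =
    Matrix.single (assemble e p 0) (assemble e q 0) 1 := by
  ext x y
  rw [padZero, selectMap_apply, Finset.univ_unique, Finset.sum_singleton, Matrix.single_apply,
    Matrix.single_apply]
  simp only [assemble_eq_iff]
  have h (P Q R S : Prop) [Decidable P] [Decidable Q] [Decidable R] [Decidable S] :
      (if R then 1 else 0) * (if P ∧ Q then 1 else 0) * star (if S then (1 : ℂ) else 0) =
        if (P ∧ R) ∧ Q ∧ S then 1 else 0 := by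
    by_cases h1 : P <;> by_cases h2 : Q <;> by_cases h3 : R <;> by_cases h4 : S <;>
      simp [h1, h2, h3, h4]
  convert h _ _ _ _

lemma trace_padZero (X : Op (Fin m → Rails k)) : (padZero e X).trace = X.trace := by
  refine trace_selectMap _ _ (fun a => ?_) X
  rw [Finset.univ_unique, Finset.sum_singleton, Finset.sum_eq_single (assemble e a 0)]
  · have h := (assemble_eq_iff e a 0 _).mp rfl
    rw [if_pos h.1.symm, if_pos h.2]
    simp
  · intro x _ hx
    by_cases h1 : (fun b t => x (e.symm (Sum.inl (b, t)))) = a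
    · rw [if_neg (fun h2 => hx ((assemble_eq_iff e a 0 x).mpr ⟨h1.symm, h2⟩).symm :
        ¬ (0 : Fin r → Fin 2) = (fun u => x (e.symm (Sum.inr u)))), zero_mul, ite_self]
    · exact if_neg h1
  · simp

/-- Each idle qubit contributes the trace of N(|0⟩⟨0|), which is 1; the other n - r uses regroup
into m blocks of k. -/
lemma traceRest_tensorPow_padZero (N : SuperOp (Fin 2) (Fin 2)) (hN : ∀ X, (N X).trace = X.trace) :
    (traceRest e).comp ((tensorPow n N).comp (padZero e)) = tensorPow m (tensorPow k N) := by
  refine superOp_ext fun a b p q => ?_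
  rw [LinearMap.comp_apply, LinearMap.comp_apply, padZero_single, traceRest, selectMap_apply,
    tensorPow_single]
  simp only [tensorPow_single, star_one, mul_one, one_mul]
  have h (z : Fin r → Fin 2) : (∏ t, N (Matrix.single (assemble e a 0 t) (assemble e b 0 t) 1)
      (assemble e p z t) (assemble e q z t)) =
      (∏ c, ∏ t, N (Matrix.single (a c t) (b c t) 1) (p c t) (q c t)) *
        ∏ u, N (Matrix.single 0 0 1) (z u) (z u) := by
    rw [← Fintype.prod_prod_type' fun c t => N (Matrix.single (a c t) (b c t) 1) (p c t) (q c t)]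
    exact (Fintype.prod_equiv e _ _ fun t => rfl).trans <|
      Fintype.prod_sum_type fun x : (Fin m × Fin k) ⊕ Fin r => N (Matrix.single
        (Sum.elim (fun c => a c.1 c.2) 0 x) (Sum.elim (fun c => b c.1 c.2) 0 x) 1)
          (Sum.elim (fun c => p c.1 c.2) z x) (Sum.elim (fun c => q c.1 c.2) z x)
  have h2 : ∑ z : Fin r → Fin 2, ∏ u, N (Matrix.single 0 0 1) (z u) (z u) = 1 := by
    have h3 := Finset.prod_univ_sum (fun _ : Fin r => (Finset.univ : Finset (Fin 2)))
      (fun _ z => N (Matrix.single 0 0 1) z z)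
    rw [Fintype.piFinset_univ] at h3
    rw [← h3]
    refine Finset.prod_eq_one fun _ _ => ?_
    exact (hN _).trans (Matrix.trace_single_eq_same _ _)
  simp only [h, ← Finset.mul_sum, h2, mul_one]

lemma star_sectorInd (s : Finset (Fin m)) (p : Fin m → Rails k) :
    star (sectorInd s p) = sectorInd s p := by
  simp only [sectorInd, star_prod, star_hotTest]

lemma isInstrument_testMap : IsInstrument (testMap e) := by
  refine isInstrument_selectMap (fun _ z p => assemble e p z) (fun s _ p => sectorInd s p) fun a => ?_
  simp only [sum_sum_ite_of_iff _ _ fun z p => assemble_eq_iff e p z a]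
  have h (s : Finset (Fin m)) (p : Fin m → Rails k) : sectorInd s p * star (sectorInd s p) =
      ∏ b, hotTest (decide (b ∈ s)) (p b) := by
    rw [star_sectorInd, sectorInd, ← Finset.prod_mul_distrib]
    simp only [hotTest_mul_self]
  simp only [h]
  rw [sum_finset_prod_decide fun b u => hotTest u fun t => a (e.symm (Sum.inl (b, t)))]
  exact Finset.prod_eq_one fun b _ => by simp [hotTest]

/-- Identifies two local measurement rounds with the projectors that define `postSelect`. -/
lemma testMap_sandwich (s t : Finset (Fin m)) (τ : Op ((Fin n → Fin 2) × (Fin n → Fin 2))) :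
    onRight _ (testMap e t) (onLeft _ (testMap e s) τ) =
      (sectorProj m k s ⊗ₖ sectorProj m k t) * tensorMap (traceRest e) (traceRest e) τ *
        (sectorProj m k s ⊗ₖ sectorProj m k t) := by
  ext p q
  rw [sectorProj_eq_diagonal, sectorProj_eq_diagonal, diagonal_kronecker_sandwich, tensorMap,
    LinearMap.comp_apply]
  simp only [onRight_apply, onLeft_apply, testMap, traceRest, selectMap_apply, Matrix.of_apply,
    star_sectorInd, star_one, mul_one, one_mul, Finset.mul_sum, Finset.sum_mul]
  exact Finset.sum_congr rfl fun _ _ => Finset.sum_congr rfl fun _ _ => by ring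
end

/-- Discard the blocks outside of `G`. -/
def discardMap {m : ℕ} (X : Type) [Fintype X] (G : Finset (Fin m)) :
    SuperOp (Fin m → X) ({b // b ∈ G} → X) :=
  selectMap (R := {b // b ∉ G} → X) (fun r x => glue G x r) fun _ _ => 1

lemma isInstrument_discardMap {m : ℕ} (X : Type) [Fintype X] (G : Finset (Fin m)) :
    IsInstrument fun _ : Unit => discardMap X G := by
  classical
  refine isInstrument_selectMap (Y := Unit) (C := fun _ => {b // b ∈ G} → X)
    (R := fun _ => {b // b ∉ G} → X) (fun _ r x => glue G x r) (fun _ _ _ => 1) fun a => ?_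
  rw [Finset.univ_unique, Finset.sum_singleton,
    sum_sum_ite_of_iff _ _ fun r x => glue_eq_iff G x r a]
  simp

lemma discardMap_discardMap {m : ℕ} {X : Type} [Fintype X] (G : Finset (Fin m))
    (ρ : Op ((Fin m → X) × (Fin m → X))) :
    onRight _ (discardMap X G) (onLeft _ (discardMap X G) ρ) = keepBlocks G ρ := by
  ext p q
  simp only [onRight_apply, onLeft_apply, discardMap, selectMap_apply, Matrix.of_apply, star_one,
    mul_one, one_mul, keepBlocks]
  exact Finset.sum_comm

lemma posSemidef_copies_railState (m k : ℕ) : (copies m (railState k)).PosSemidef := by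
  have h : copies m (railState k) = Matrix.vecMulVec
      (fun p : (Fin m → Rails k) × (Fin m → Rails k) => ∏ b, railVec k (p.1 b, p.2 b))
      (star fun p : (Fin m → Rails k) × (Fin m → Rails k) => ∏ b, railVec k (p.1 b, p.2 b)) := by
    ext p q
    simp only [copies, Matrix.of_apply, railState_apply, Finset.prod_mul_distrib,
      Matrix.vecMulVec_apply, Pi.star_apply, star_prod]
  rw [h]
  exact Matrix.posSemidef_vecMulVec_self_star _

/-- Post-selection is LOCC: one test round per receiver announces s and t, two rounds with a single
outcome discard the blocks outside s ∩ t, and K (s ∩ t) follows. -/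
lemma HasRailCode.hasEPRCode {γ₁ γ₂ : ℝ} (h₁ : γ₁ ∈ Set.Icc (0 : ℝ) 1)
    (h₂ : γ₂ ∈ Set.Icc (0 : ℝ) 1) {k m κ : ℕ} (hk : 1 ≤ k) {ε : ℝ} (h : HasRailCode γ₁ γ₂ k m κ ε)
    {n : ℕ} (hn : m * k ≤ n) : HasEPRCode (ampDamp γ₁) (ampDamp γ₂) n κ ε := by
  obtain ⟨K, hK, hε⟩ := h
  -- Any bijection will do: the n uses of a channel are identical.
  let e : Fin n ≃ (Fin m × Fin k) ⊕ Fin (n - m * k) :=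
    Fintype.equivOfCardEq (by simp [Nat.add_sub_cancel' hn])
  refine ⟨tensorMap (padZero e) (padZero e) (copies m (railState k)),
    ∑ s, (∑ t, (∑ _ : Unit, (∑ _ : Unit, (K (s ∩ t)).comp (onRight _ (discardMap _ (s ∩ t)))).comp
      (onLeft _ (discardMap _ (s ∩ t)))).comp (onRight _ (testMap e t))).comp
        (onLeft _ (testMap e s)), ⟨?_, ?_⟩, ?_, ?_⟩
  · rw [tensorMap, LinearMap.comp_apply]
    exact posSemidef_onRight_selectMap _ _
      (posSemidef_onLeft_selectMap _ _ (posSemidef_copies_railState m k))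
  · rw [trace_tensorMap _ _ (trace_padZero e) (trace_padZero e), copies_eq_prodOp,
      trace_prodOp_railState _ hk]
  · exact IsLOCC.left _ _ (isInstrument_testMap e) fun s => IsLOCC.right _ _ (isInstrument_testMap e)
      fun t => IsLOCC.left _ _ (isInstrument_discardMap _ (s ∩ t)) fun _ =>
        IsLOCC.right _ _ (isInstrument_discardMap _ (s ∩ t)) fun _ => hK _
  · have hL (τ : Op ((Fin n → Fin 2) × (Fin n → Fin 2))) :
        (∑ s, (∑ t, (∑ _ : Unit, (∑ _ : Unit, (K (s ∩ t)).comp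
          (onRight _ (discardMap _ (s ∩ t)))).comp (onLeft _ (discardMap _ (s ∩ t)))).comp
            (onRight _ (testMap e t))).comp (onLeft _ (testMap e s))) τ =
        postSelect K (tensorMap (traceRest e) (traceRest e) τ) := by
      simp only [Finset.univ_unique, Finset.sum_singleton, LinearMap.sum_apply,
        LinearMap.comp_apply, testMap_sandwich, discardMap_discardMap, postSelect]
    have hN : tensorMap (traceRest e) (traceRest e) (tensorMap (tensorPow n (ampDamp γ₁))
        (tensorPow n (ampDamp γ₂)) (tensorMap (padZero e) (padZero e) (copies m (railState k)))) =
        tensorMap (tensorPow m (tensorPow k (ampDamp γ₁))) (tensorPow m (tensorPow k (ampDamp γ₂)))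
          (copies m (railState k)) := by
      rw [← traceRest_tensorPow_padZero e _ (trace_ampDamp h₁),
        ← traceRest_tensorPow_padZero e _ (trace_ampDamp h₂), tensorMap_comp, tensorMap_comp]
      rfl
    rw [hL, hN]
    exact hε

/-! ### Asymptotics -/

open Filter Topology in
-- A squeeze: per block, the slack costs log₂ k · m^(-1/3) and the floor at most 1/m.
lemma tendsto_railYield {p : ℝ} (hp : 0 ≤ p) {k : ℕ} (hk : 1 ≤ k) :
    Tendsto (fun m : ℕ => (railYield p k m : ℝ) / (m * k)) atTop
      (𝓝 (p * Real.logb 2 k / k)) := by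
  have hk0 : (0 : ℝ) < k := by exact_mod_cast hk
  have hlog : 0 ≤ Real.logb 2 k := Real.logb_nonneg one_lt_two (by exact_mod_cast hk)
  have h1 : Tendsto (fun m : ℕ => (Real.logb 2 k * (p - (m : ℝ) ^ (-(1 / 3) : ℝ)) - (m : ℝ)⁻¹) / k)
      atTop (𝓝 ((Real.logb 2 k * (p - 0) - 0) / k)) :=
    (((tendsto_const_nhds.sub ((tendsto_rpow_neg_atTop (by norm_num)).comp
      tendsto_natCast_atTop_atTop)).const_mul _).sub
        (tendsto_inv_atTop_zero.comp tendsto_natCast_atTop_atTop)).div_const _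
  rw [sub_zero, sub_zero, mul_comm _ p] at h1
  refine tendsto_of_tendsto_of_tendsto_of_le_of_le' h1 tendsto_const_nhds ?_ ?_
  · filter_upwards [eventually_gt_atTop 0] with m hm
    have hm0 : (0 : ℝ) < m := by exact_mod_cast hm
    have e1 : (m : ℝ) ^ (2 / 3 : ℝ) = m * (m : ℝ) ^ (-(1 / 3) : ℝ) := by
      rw [← Real.rpow_one_add' hm0.le (by norm_num)]
      norm_num
    have h2 : Real.logb 2 k * (m * p - (m : ℝ) ^ (2 / 3 : ℝ)) < railYield p k m + 1 :=
      Nat.lt_floor_add_one _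
    rw [e1] at h2
    rw [← div_div]
    refine div_le_div_of_nonneg_right ?_ hk0.le
    rw [le_div_iff₀ hm0, sub_mul, inv_mul_cancel₀ hm0.ne']
    linarith
  · filter_upwards [eventually_gt_atTop 0] with m hm
    have hm0 : (0 : ℝ) < m := by exact_mod_cast hm
    rw [← div_div]
    refine div_le_div_of_nonneg_right ?_ hk0.le
    rw [div_le_iff₀ hm0]
    -- The floor of a negative number is 0, so the upper bound by its argument is available only for
    -- a nonzero yield.
    by_cases h0 : railYield p k m = 0
    · rw [h0, Nat.cast_zero]
      positivity
    · have hle : (railYield p k m : ℝ) ≤ Real.logb 2 k * (m * p - (m : ℝ) ^ (2 / 3 : ℝ)) :=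
        Nat.floor_le (zero_le_one.trans (Nat.floor_pos.mp (Nat.pos_of_ne_zero h0)))
      have : 0 ≤ Real.logb 2 k * (m : ℝ) ^ (2 / 3 : ℝ) := by positivity
      linarith

open Filter Topology in
lemma tendsto_two_mul_exp_neg_rpow :
    Tendsto (fun m : ℕ => 2 * Real.exp (-((m : ℝ) ^ (1 / 3 : ℝ) / 4))) atTop (𝓝 0) := by
  have h1 : Tendsto (fun m : ℕ => (m : ℝ) ^ (1 / 3 : ℝ) / 4) atTop atTop :=
    ((tendsto_rpow_atTop (by norm_num)).comp tendsto_natCast_atTop_atTop).atTop_div_const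
      (by norm_num)
  simpa using (Real.tendsto_exp_neg_atTop_nhds_zero.comp h1).const_mul 2

open Filter Topology in
lemma tendsto_div_mul_div {k : ℕ} (hk : 1 ≤ k) :
    Tendsto (fun n : ℕ => ((n / k : ℕ) : ℝ) * k / n) atTop (𝓝 1) := by
  have hk0 : (0 : ℝ) < k := by exact_mod_cast hk
  have h1 : Tendsto (fun n : ℕ => 1 - (k : ℝ) * (n : ℝ)⁻¹) atTop (𝓝 (1 - k * 0)) :=
    tendsto_const_nhds.sub ((tendsto_inv_atTop_zero.comp tendsto_natCast_atTop_atTop).const_mul _)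
  rw [mul_zero, sub_zero] at h1
  refine tendsto_of_tendsto_of_tendsto_of_le_of_le' h1 tendsto_const_nhds ?_ ?_
  · filter_upwards [eventually_gt_atTop 0] with n hn
    have hn0 : (0 : ℝ) < n := by exact_mod_cast hn
    rw [le_div_iff₀ hn0, sub_mul, one_mul, mul_assoc, inv_mul_cancel₀ hn0.ne', mul_one]
    have : n ≤ n / k * k + k := by
      have := Nat.div_add_mod' n k
      have := Nat.mod_lt n hk
      omega
    have : (n : ℝ) ≤ (n / k : ℕ) * k + k := by exact_mod_cast this
    linarith
  · filter_upwards [eventually_gt_atTop 0] with n hn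
    have hn0 : (0 : ℝ) < n := by exact_mod_cast hn
    rw [div_le_one hn0]
    exact_mod_cast Nat.div_mul_le_self n k

section
variable {γ₁ γ₂ : ℝ} (h₁ : γ₁ ∈ Set.Icc (0 : ℝ) 1) (h₂ : γ₂ ∈ Set.Icc (0 : ℝ) 1)
include h₁ h₂

lemma isRailAchievable_railRate {k : ℕ} (hk : 1 ≤ k) :
    IsRailAchievable γ₁ γ₂ k (railRate γ₁ γ₂ k) :=
  ⟨railYield ((1 - γ₁) * (1 - γ₂)) k, fun m => 2 * Real.exp (-((m : ℝ) ^ (1 / 3 : ℝ) / 4)),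
    fun m _ => hasRailCode_railYield h₁ h₂ hk m,
    tendsto_railYield (mul_nonneg (by linarith [h₁.2]) (by linarith [h₂.2])) hk,
    tendsto_two_mul_exp_neg_rpow⟩

open Filter Topology in
-- Use m = ⌊n/k⌋ blocks; the fraction mk/n of channel uses that carry rails tends to 1.
lemma isAchievable_railRate {k : ℕ} (hk : 1 ≤ k) :
    IsAchievable (ampDamp γ₁) (ampDamp γ₂) (railRate γ₁ γ₂ k) := by
  have hdiv : Tendsto (fun n : ℕ => n / k) atTop atTop :=
    Nat.tendsto_div_const_atTop (by omega)
  refine ⟨fun n => railYield ((1 - γ₁) * (1 - γ₂)) k (n / k),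
    fun n => 2 * Real.exp (-(((n / k : ℕ) : ℝ) ^ (1 / 3 : ℝ) / 4)), fun n _ =>
      (hasRailCode_railYield h₁ h₂ hk (n / k)).hasEPRCode h₁ h₂ hk (Nat.div_mul_le_self n k), ?_,
    tendsto_two_mul_exp_neg_rpow.comp hdiv⟩
  have h := ((tendsto_railYield (mul_nonneg (by linarith [h₁.2]) (by linarith [h₂.2]) :
    0 ≤ (1 - γ₁) * (1 - γ₂)) hk).comp hdiv).mul (tendsto_div_mul_div hk)
  rw [mul_one] at h
  refine h.congr' ?_
  filter_upwards [eventually_ge_atTop k] with n hn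
  have h0 : ((n / k : ℕ) : ℝ) * k ≠ 0 := by
    have h1 : n / k ≠ 0 := (Nat.div_pos hn hk).ne'
    have h2 : k ≠ 0 := by omega
    exact_mod_cast mul_ne_zero h1 h2
  exact div_mul_div_cancel₀ h0

lemma railRate_le_capacity {k : ℕ} (hk : 1 ≤ k) :
    ((railRate γ₁ γ₂ k : ℝ) : EReal) ≤ capacity (ampDamp γ₁) (ampDamp γ₂) :=
  le_iSup₂ (f := fun (R : ℝ) (_ : IsAchievable (ampDamp γ₁) (ampDamp γ₂) R) => (R : EReal))
    _ (isAchievable_railRate h₁ h₂ hk)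
end

/-- For k ≥ 3 > e, log x / x is decreasing. For k = 2 the claim is 2³ ≤ 3², and for k = 1 the left
side is 0. -/
lemma logb_div_self_le (k : ℕ) (hk : 1 ≤ k) : Real.logb 2 k / k ≤ Real.logb 2 3 / 3 := by
  have hl2 : 0 < Real.log 2 := Real.log_pos one_lt_two
  simp only [Real.logb, div_right_comm _ (Real.log 2)]
  refine div_le_div_of_nonneg_right ?_ hl2.le
  have hl3 : 0 < Real.log 3 := Real.log_pos (by norm_num)
  rcases (by omega : k = 1 ∨ k = 2 ∨ 3 ≤ k) with rfl | rfl | hk3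
  · simp
    positivity
  · have h : Real.log (2 ^ 3) ≤ Real.log (3 ^ 2) := Real.log_le_log (by norm_num) (by norm_num)
    rw [Real.log_pow, Real.log_pow] at h
    push_cast at h ⊢
    linarith
  · have h3 : Real.exp 1 ≤ 3 := by linarith [Real.exp_one_lt_d9]
    have hk3' : (3 : ℝ) ≤ k := by exact_mod_cast hk3
    exact Real.log_div_self_antitoneOn h3 (h3.trans hk3') hk3'

end

end EPRDist

open EPRDist
theorem mainTheorem9 (γ₁ γ₂ : ℝ) (hγ₁ : γ₁ ∈ Set.Icc (0 : ℝ) 1) (hγ₂ : γ₂ ∈ Set.Icc (0 : ℝ) 1) :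
    (∀ k : ℕ, 1 ≤ k →
      -- the post-selected operator is the maximally entangled state, with success probability
      -- `(1 - γ₁)(1 - γ₂)`
      IsMaxEntangled k (railState k) ∧
      ((oneParticle k ⊗ₖ oneParticle k) * railOutput γ₁ γ₂ k *
          (oneParticle k ⊗ₖ oneParticle k)).trace = (((1 - γ₁) * (1 - γ₂) : ℝ) : ℂ) ∧
      ((1 - γ₁) * (1 - γ₂) ≠ 0 →
        ((oneParticle k ⊗ₖ oneParticle k) * railOutput γ₁ γ₂ k *
            (oneParticle k ⊗ₖ oneParticle k)).trace⁻¹ •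
          ((oneParticle k ⊗ₖ oneParticle k) * railOutput γ₁ γ₂ k *
            (oneParticle k ⊗ₖ oneParticle k)) = railState k) ∧
      -- the multi-rail protocol achieves the rate, which is a lower bound for the capacity
      IsRailAchievable γ₁ γ₂ k (railRate γ₁ γ₂ k) ∧
      ((railRate γ₁ γ₂ k : ℝ) : EReal) ≤ capacity (ampDamp γ₁) (ampDamp γ₂)) ∧
    -- the rate is maximal at `k = 3`
    IsGreatest {R : ℝ | ∃ k : ℕ, 1 ≤ k ∧ R = Real.logb 2 k / k} (Real.logb 2 3 / 3) ∧
    IsGreatest {R : ℝ | ∃ k : ℕ, 1 ≤ k ∧ R = railRate γ₁ γ₂ k}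
      ((1 - γ₁) * (1 - γ₂) * Real.logb 2 3 / 3) ∧
    (((1 - γ₁) * (1 - γ₂) * Real.logb 2 3 / 3 : ℝ) : EReal) ≤
      capacity (ampDamp γ₁) (ampDamp γ₂) := by
  have hp : 0 ≤ (1 - γ₁) * (1 - γ₂) :=
    mul_nonneg (by linarith [hγ₁.2]) (by linarith [hγ₂.2])
  have h3 : railRate γ₁ γ₂ 3 = (1 - γ₁) * (1 - γ₂) * Real.logb 2 3 / 3 := by
    simp [railRate]
  refine ⟨fun k hk => ⟨isMaxEntangled_railState k, ?_, fun h => ?_,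
    isRailAchievable_railRate hγ₁ hγ₂ hk, railRate_le_capacity hγ₁ hγ₂ hk⟩, ⟨⟨3, by norm_num⟩, ?_⟩,
    ⟨⟨3, by norm_num, h3.symm⟩, ?_⟩, ?_⟩
  · rw [oneParticle_sandwich hγ₁ hγ₂, Matrix.trace_smul, trace_railState hk, smul_eq_mul, mul_one]
  · rw [oneParticle_sandwich hγ₁ hγ₂, Matrix.trace_smul, trace_railState hk, smul_eq_mul, mul_one,
      smul_smul, inv_mul_cancel₀ (Complex.ofReal_ne_zero.mpr h), one_smul]
  · rintro R ⟨k, hk, rfl⟩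
    exact logb_div_self_le k hk
  · rintro R ⟨k, hk, rfl⟩
    rw [railRate, mul_div_assoc, mul_div_assoc]
    exact mul_le_mul_of_nonneg_left (logb_div_self_le k hk) hp
  · rw [← h3]
    exact railRate_le_capacity hγ₁ hγ₂ (by norm_num)
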